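/- A map $\mathcal L\colon \mathbb F^k\to\mathbb F^n$ over a finite field $\mathbb F$ is a $(q,\delta,\varepsilon)$-locally correctable code (LCC) if there is a randomized (possibly adaptive) algorithm $\mathrm{Dec}$ that, given an index $u\in[n]$ and oracle access to a string $y\in\mathbb F^n$, makes at most $q$ queries to $y$ and satisfies $\Pr[\mathrm{Dec}^{y}(u)=\mathcal L(b)_u]\ge \frac12+\varepsilon$ for all $b\in\mathbb F^k$, all $u\in[n]$ and all $y\in\mathbb F^n$ that differ from $\mathcal L(b)$ in at most $\delta n$ coordinates. It is a linear code if $\mathcal L$ is linear and injective, so that its image has dimension $k$. **Theorem.** There is an absolute constant $c>0$ such that the following holds. Let $\mathbb F$ be a finite field, let $k\ge 0$ and $n\ge 2$ be integers, let $\delta,\varepsilon>0$ be real numbers, and let $\mathcal L\colon\mathbb F^k\to\mathbb F^n$ be a linear $(3,\delta,\varepsilon)$-locally correctable code. Then $$n\;\ge\;2^{\,c\,\left(\delta^2k/(|\mathbb F|-1)^2\right)^{1/8}}.$$ In particular, for every $\delta>0$ there is a constant $c_\delta>0$, depending only on $\delta$, such that every linear $(3,\delta,\varepsilon)$-locally correctable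 code $\mathcal L\colon\mathbb F_2^k\to\mathbb F_2^n$ with $n\ge2$ and $\varepsilon>0$ satisfies $n\ge 2^{c_\delta k^{1/8}}$. -/

import Mathlib

/-- Deterministic adaptive query algorithms (decision trees) that make at most `q` queries to a
string `y : ι → F` and output a symbol of `F`: either output a symbol, or, if at least one query
is left, read a position `i` of the string and continue depending on the symbol that was read. -/
inductive QueryAlg (ι F : Type*) : ℕ → Type _
  | output {q : ℕ} (a : F) : QueryAlg ι F q
  | query {q : ℕ} (i : ι) (next : F → QueryAlg ι F q) : QueryAlg ι F (q + 1)

/-- The output of a deterministic query algorithm with oracle access to the string `y`. -/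
def QueryAlg.run {ι F : Type*} (y : ι → F) : {q : ℕ} → QueryAlg ι F q → F
  | _, .output a => a
  | _, .query i next => (next (y i)).run y

/-- A map `L : F^k → F^n` is a `(q, δ, ε)`-locally correctable code. The randomized decoder is
given, for every position `u`, by a probability distribution on deterministic algorithms that make
at most `q` queries (the random coins select the algorithm that is run), and
`((Dec u).map (QueryAlg.run y)) a` is the probability that it outputs `a` when it is run on the
string `y`. -/
def IsLCC {F : Type*} [DecidableEq F] {k n : ℕ} (q : ℕ) (δ ε : ℝ)
    (L : (Fin k → F) → (Fin n → F)) : Prop :=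
  ∃ Dec : Fin n → PMF (QueryAlg (Fin n) F q),
    ∀ (b : Fin k → F) (u : Fin n) (y : Fin n → F),
      (hammingDist y (L b) : ℝ) ≤ δ * n →
        1 / 2 + ε ≤ (((Dec u).map (QueryAlg.run y)) (L b u)).toReal

/-!
The code is turned into a combinatorial object whose size is `n ^ polylog n` and which moves in
`k` independent directions; an entropy inequality then bounds `k`.

*Local relations.* Erase any `δ n` positions. A decoder of a linear code that is right with
probability more than `1 / 2` must read positions that determine position `u`, since otherwise the
symbol at `u` stays uniformly distributed given what was read (`IsLCC.exists_determining`). Hence,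
greedily, every `u` has about `δ n / 3` disjoint relations that express it through three positions
(`IsLCC.exists_relations`).

*Walks.* Let the tokens be the pairs of a position and a coefficient, each attached to a vector of
`F ^ k`; there are `N = n |F|` of them. Every token `s` has `m` moves
`φ s = φ (A s t) - φ (Bf s t) + φ (C s t)`, where `A s`, `Bf s` and `C s` are injective in `t`. Take
words made of `R ≈ log N` blocks of `h` tokens. A walk from `v` finds in each block in turn a token
`A s t`, `s` being the current state, overwrites it by `Bf s t`, and passes to the state `C s t`.
The word read, together with the last state `u`, then exceeds the word written by exactly `φ v`. For
`ρ = m / N` and `h` of order `R² log N / ρ`, the weighted graph of all walks from `v` satisfies,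
after a small loss in every block:

* the number of walks that write a given word is at most a constant times its mean, by Chernoff's
  bound (`card_bad_right_le`);
* the number of walks with a given word read and a given last state is bounded by a function `a`
  that does not depend on `v` and whose total is `O(1 / ρ)` times the number of words. The reason is
  that a random block averages over the states reachable by one move, so that it halves the maximum
  over `v` of this number or brings it down to `O(1 / ρ)` times the mean over `v`
  (`card_bad_left_le`); after `log N` blocks only the mean matters, whose total is controlled since
  the total number of walks is.

These properties are the fields of `WalkSystem`, and `WalkSystem.succ` adds a block.

*Entropy.* Push the two bounds forward to a weight `f` on `F ^ k`. For each of the `k` basis vectors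
`e i`, which all occur as `φ v`, the walks from `v` show that `f z` and `f (z + e i)` share a
proportion of order `ρ` of the total weight. By the edge-isoperimetric inequality
`log_two_mul_sum_sum_min_le` this makes `k ρ` at most of the order of the entropy of `f`, which is
at most the logarithm of the number of words. This gives `k = O(log ^ 5 N / ρ ^ 2)`
(`dimension_le_of_moves`), where `1 / ρ = O((|F| - 1) / δ)`.
-/

universe u

/-! ### Fibre sums and concentration for random blocks -/

/-- The fibre sum `w ↦ ∑_{t : α t = w} q t`. -/
noncomputable def fiberSum {W ι : Type*} [Fintype ι] (α : ι → W) (q : ι → ℝ) (w : W) : ℝ :=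
  open Classical in ∑ t, if w = α t then q t else 0

theorem fiberSum_nonneg {W ι : Type*} [Fintype ι] (α : ι → W) {q : ι → ℝ} (hq : ∀ t, 0 ≤ q t)
    (w : W) : 0 ≤ fiberSum α q w :=
  Finset.sum_nonneg fun t _ => by split_ifs; exacts [hq t, le_rfl]

theorem fiberSum_mono {W ι : Type*} [Fintype ι] (α : ι → W) {q q' : ι → ℝ}
    (hq : ∀ t, q t ≤ q' t) (w : W) : fiberSum α q w ≤ fiberSum α q' w :=
  Finset.sum_le_sum fun t _ => by split_ifs; exacts [hq t, le_rfl]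

theorem fiberSum_le {W ι : Type*} [Fintype ι] {α : ι → W} (hα : Function.Injective α)
    {q : ι → ℝ} {a : ℝ} (ha : 0 ≤ a) (hq : ∀ t, q t ≤ a) (w : W) : fiberSum α q w ≤ a := by
  classical
  unfold fiberSum
  by_cases h : ∃ t, w = α t
  · obtain ⟨t, rfl⟩ := h
    rw [Finset.sum_eq_single t]
    · simpa using hq t
    · intro s _ hs
      rw [if_neg fun h => hs (hα h).symm]
    · simp
  · push Not at h
    rw [Finset.sum_eq_zero fun t _ => if_neg (h t)]
    exact ha

theorem sum_fiberSum {W ι : Type*} [Fintype W] [Fintype ι] (α : ι → W) (q : ι → ℝ) :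
    ∑ w, fiberSum α q w = ∑ t, q t := by
  classical
  unfold fiberSum
  rw [Finset.sum_comm]
  simp

theorem fiberSum_mul_const {W ι : Type*} [Fintype ι] (α : ι → W) (q : ι → ℝ) (c : ℝ) (w : W) :
    fiberSum α (fun t => q t * c) w = fiberSum α q w * c := by
  classical
  unfold fiberSum
  rw [Finset.sum_mul]
  exact Finset.sum_congr rfl fun t _ => by split_ifs <;> simp

theorem fiberSum_sum {W ι κ : Type*} [Fintype ι] [Fintype κ] (α : ι → W) (q : κ → ι → ℝ)
    (w : W) : ∑ y, fiberSum α (q y) w = fiberSum α (fun t => ∑ y, q y t) w := by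
  classical
  unfold fiberSum
  rw [Finset.sum_comm]
  exact Finset.sum_congr rfl fun t _ => by split_ifs <;> simp

theorem sum_pi_eval {W : Type*} [Fintype W] {h : ℕ} (p : Fin h) (q : W → ℝ) :
    (Fintype.card W : ℝ) * ∑ B : Fin h → W, q (B p) = (Fintype.card W : ℝ) ^ h * ∑ w, q w := by
  classical
  have h1 : ∑ B : Fin h → W, q (B p) =
      ∑ x : W × ({j // j ≠ p} → W), q x.1 :=
    Fintype.sum_equiv (Equiv.funSplitAt p W) _ _ fun B => rfl
  have h2 : Fintype.card (Fin h → W) = Fintype.card (W × ({j // j ≠ p} → W)) :=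
    Fintype.card_congr (Equiv.funSplitAt p W)
  have h3 : (Fintype.card W : ℝ) ^ h =
      Fintype.card W * Fintype.card ({j // j ≠ p} → W) := by
    rw [Fintype.card_prod, Fintype.card_fun, Fintype.card_fin] at h2
    exact_mod_cast h2
  rw [h1, h3, Fintype.sum_prod_type]
  simp only [Finset.sum_const, Finset.card_univ, nsmul_eq_mul, ← Finset.mul_sum]
  ring

/-- Chernoff's bound, in counting form, for the sum of `h` independent copies of a
`[0, 1]`-valued function of mean at most `μ`. -/
theorem card_filter_sum_gt_le {W : Type*} [Fintype W] {h : ℕ} (q : W → ℝ)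
    (h0 : ∀ w, 0 ≤ q w) (h1 : ∀ w, q w ≤ 1) {μ lam τ : ℝ}
    (hμ : ∑ w, q w ≤ μ * Fintype.card W) (hl : 0 ≤ lam) (P : (Fin h → W) → Prop)
    [DecidablePred P] (hP : ∀ B, P B → τ ≤ ∑ p, q (B p)) :
    ((Finset.univ.filter P).card : ℝ) ≤
      (Fintype.card W : ℝ) ^ h * Real.exp (h * (μ * (Real.exp lam - 1)) - lam * τ) := by
  have hexp : ∀ w, Real.exp (lam * q w) ≤ 1 + q w * (Real.exp lam - 1) := by
    intro w
    have := convexOn_exp.2 (Set.mem_univ (0 : ℝ)) (Set.mem_univ lam)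
      (sub_nonneg.2 (h1 w)) (h0 w) (by ring)
    simp only [smul_eq_mul, mul_zero, zero_add, Real.exp_zero, mul_one] at this
    rw [mul_comm lam]
    linarith
  have hE : 0 ≤ Real.exp lam - 1 := by
    have := Real.add_one_le_exp lam
    linarith
  have hsum : ∑ w, Real.exp (lam * q w) ≤
      Fintype.card W * Real.exp (μ * (Real.exp lam - 1)) := by
    calc ∑ w, Real.exp (lam * q w) ≤ ∑ w, (1 + q w * (Real.exp lam - 1)) :=
          Finset.sum_le_sum fun w _ => hexp w
      _ = Fintype.card W + (∑ w, q w) * (Real.exp lam - 1) := by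
          rw [Finset.sum_add_distrib, Finset.sum_mul]; simp
      _ ≤ Fintype.card W + (μ * Fintype.card W) * (Real.exp lam - 1) := by gcongr
      _ = Fintype.card W * (μ * (Real.exp lam - 1) + 1) := by ring
      _ ≤ _ := by gcongr; exact Real.add_one_le_exp _
  have hmarkov : ((Finset.univ.filter P).card : ℝ) * Real.exp (lam * τ) ≤
      (∑ w, Real.exp (lam * q w)) ^ h := by
    calc ((Finset.univ.filter P).card : ℝ) * Real.exp (lam * τ)
        = ∑ B ∈ Finset.univ.filter P, Real.exp (lam * τ) := by simp
      _ ≤ ∑ B ∈ Finset.univ.filter P, ∏ p, Real.exp (lam * q (B p)) := by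
          refine Finset.sum_le_sum fun B hB => ?_
          rw [← Real.exp_sum, ← Finset.mul_sum]
          have := hP B (Finset.mem_filter.1 hB).2
          gcongr
      _ ≤ ∑ B : Fin h → W, ∏ p, Real.exp (lam * q (B p)) :=
          Finset.sum_le_sum_of_subset_of_nonneg (Finset.filter_subset _ _)
            fun B _ _ => Finset.prod_nonneg fun p _ => (Real.exp_pos _).le
      _ = (∑ w, Real.exp (lam * q w)) ^ h := by
          classical
          have := Finset.prod_univ_sum (fun _ : Fin h => (Finset.univ : Finset W))
            (fun _ w => Real.exp (lam * q w))
          rw [Finset.prod_const, Finset.card_univ, Fintype.card_fin] at this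
          rw [this, Fintype.piFinset_univ]
  have h2 : (∑ w, Real.exp (lam * q w)) ^ h ≤
      (Fintype.card W : ℝ) ^ h * Real.exp (h * (μ * (Real.exp lam - 1))) := by
    calc _ ≤ (Fintype.card W * Real.exp (μ * (Real.exp lam - 1))) ^ h :=
          pow_le_pow_left₀ (Finset.sum_nonneg fun w _ => (Real.exp_pos _).le) hsum h
      _ = _ := by rw [mul_pow, Real.exp_nat_mul]
  rw [Real.exp_sub, ← mul_div_assoc, le_div_iff₀ (Real.exp_pos _)]
  exact hmarkov.trans h2

/-! ### The edge-isoperimetric inequality for weights on `F ^ k` -/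

/-- The one-dimensional case of the edge-isoperimetric inequality: all weights but at most one are
at most half of the total, and each of them has `log (total / weight) ≥ log 2`. -/
theorem log_two_mul_sum_min_le {F : Type*} [AddGroup F] [Fintype F] (g : F) (hg : g ≠ 0)
    (w : F → ℝ) (hw : ∀ c, 0 ≤ w c) :
    Real.log 2 * ∑ c, min (w c) (w (c + g)) ≤
      2 * ((∑ c, w c) * Real.log (∑ c, w c) - ∑ c, w c * Real.log (w c)) := by
  classical
  obtain ⟨c₀, -, hc₀⟩ := Finset.exists_max_image Finset.univ w ⟨(0 : F), Finset.mem_univ _⟩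
  set T := ∑ c, w c with hT
  have hle : ∀ c, w c ≤ T := fun c => Finset.single_le_sum (fun c _ => hw c) (Finset.mem_univ c)
  have hrest : ∑ c ∈ Finset.univ.erase c₀, w c = T - w c₀ := by
    rw [hT, ← Finset.add_sum_erase _ w (Finset.mem_univ c₀)]; ring
  have hmin : ∑ c, min (w c) (w (c + g)) ≤ 2 * (T - w c₀) := by
    rw [← Finset.add_sum_erase _ _ (Finset.mem_univ c₀)]
    have h1 : min (w c₀) (w (c₀ + g)) ≤ T - w c₀ := by
      rw [← hrest]
      refine (min_le_right _ _).trans ?_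
      exact Finset.single_le_sum (f := w) (fun c _ => hw c)
        (Finset.mem_erase.2 ⟨by simpa using hg, Finset.mem_univ _⟩)
    have h2 : ∑ c ∈ Finset.univ.erase c₀, min (w c) (w (c + g)) ≤ T - w c₀ := by
      rw [← hrest]
      exact Finset.sum_le_sum fun c _ => min_le_left _ _
    linarith
  have hterm : ∀ c, 0 ≤ w c * (Real.log T - Real.log (w c)) := by
    intro c
    rcases (hw c).eq_or_lt with h | h
    · rw [← h]; simp
    · exact mul_nonneg (hw c) (sub_nonneg.2 (Real.log_le_log h (hle c)))
  have hbig : ∀ c ∈ Finset.univ.erase c₀,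
      w c * Real.log 2 ≤ w c * (Real.log T - Real.log (w c)) := by
    intro c hc
    rcases (hw c).eq_or_lt with h | h
    · rw [← h]; simp
    · refine mul_le_mul_of_nonneg_left ?_ (hw c)
      have h2 : 2 * w c ≤ T := by
        have : w c ≤ T - w c₀ := by
          rw [← hrest]
          exact Finset.single_le_sum (f := w) (fun c _ => hw c) hc
        have := hc₀ c (Finset.mem_univ _)
        linarith
      have := Real.log_le_log (by positivity) h2
      rw [Real.log_mul (by norm_num) h.ne'] at this
      linarith
  have hJ : Real.log 2 * (T - w c₀) ≤ T * Real.log T - ∑ c, w c * Real.log (w c) := by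
    calc Real.log 2 * (T - w c₀) = ∑ c ∈ Finset.univ.erase c₀, w c * Real.log 2 := by
          rw [← Finset.sum_mul, hrest]; ring
      _ ≤ ∑ c ∈ Finset.univ.erase c₀, w c * (Real.log T - Real.log (w c)) :=
          Finset.sum_le_sum hbig
      _ ≤ ∑ c, w c * (Real.log T - Real.log (w c)) :=
          Finset.sum_le_sum_of_subset_of_nonneg (Finset.erase_subset _ _) fun c _ _ => hterm c
      _ = _ := by
          simp_rw [mul_sub]
          rw [Finset.sum_sub_distrib, ← Finset.sum_mul]
  have hlog : 0 ≤ Real.log 2 := Real.log_nonneg (by norm_num)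
  calc Real.log 2 * ∑ c, min (w c) (w (c + g)) ≤ Real.log 2 * (2 * (T - w c₀)) := by gcongr
    _ = 2 * (Real.log 2 * (T - w c₀)) := by ring
    _ ≤ _ := by gcongr

/-- Edge-isoperimetric inequality in `F ^ k`, for weights instead of sets: the total weight of the
edges in the coordinate directions is at most twice the (unnormalized) entropy in bits. -/
theorem log_two_mul_sum_sum_min_le {F : Type*} [AddCommGroup F] [Fintype F] (g : F) (hg : g ≠ 0) :
    ∀ (k : ℕ) (f : (Fin k → F) → ℝ), (∀ z, 0 ≤ f z) →
      Real.log 2 * ∑ i : Fin k, ∑ z, min (f z) (f (z + Pi.single i g)) ≤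
        2 * ((∑ z, f z) * Real.log (∑ z, f z) - ∑ z, f z * Real.log (f z)) := by
  intro k
  induction k with
  | zero => intro f _; simp
  | succ k ih =>
    intro f hf
    have hsplit : ∀ q : (Fin (k + 1) → F) → ℝ, ∑ z, q z = ∑ c, ∑ z, q (Fin.cons c z) := by
      intro q
      rw [← Fintype.sum_prod_type' (fun (c : F) (z : Fin k → F) => q (Fin.cons c z))]
      exact (Fintype.sum_equiv (Fin.consEquiv fun _ => F) _ _ fun x => rfl).symm
    have hzero : ∀ (c : F) (z : Fin k → F),
        (Fin.cons c z + Pi.single 0 g : Fin (k + 1) → F) = Fin.cons (c + g) z := by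
      intro c z
      ext j
      refine Fin.cases ?_ (fun j => ?_) j <;> simp
    have hsucc : ∀ (i : Fin k) (c : F) (z : Fin k → F),
        (Fin.cons c z + Pi.single i.succ g : Fin (k + 1) → F) =
          Fin.cons c (z + Pi.single i g) := by
      intro i c z
      ext j
      refine Fin.cases ?_ (fun j => ?_) j
      · simp
      · simp [Pi.single_apply]
    have h1 := log_two_mul_sum_min_le g hg (fun c => ∑ z, f (Fin.cons c z))
      fun c => Finset.sum_nonneg fun z _ => hf _
    have h2 : ∑ z : Fin (k + 1) → F, min (f z) (f (z + Pi.single 0 g)) ≤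
        ∑ c, min (∑ z, f (Fin.cons c z)) (∑ z, f (Fin.cons (c + g) z)) := by
      rw [hsplit]
      refine Finset.sum_le_sum fun c _ => ?_
      simp_rw [hzero]
      exact le_min (Finset.sum_le_sum fun z _ => min_le_left _ _)
        (Finset.sum_le_sum fun z _ => min_le_right _ _)
    have h3 : ∀ c : F, Real.log 2 * ∑ i : Fin k, ∑ z,
        min (f (Fin.cons c z)) (f (Fin.cons c (z + Pi.single i g))) ≤
        2 * ((∑ z, f (Fin.cons c z)) * Real.log (∑ z, f (Fin.cons c z)) -
          ∑ z, f (Fin.cons c z) * Real.log (f (Fin.cons c z))) :=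
      fun c => ih (fun z => f (Fin.cons c z)) fun z => hf _
    have h4 := Finset.sum_le_sum fun c (_ : c ∈ (Finset.univ : Finset F)) => h3 c
    rw [← Finset.mul_sum, ← Finset.mul_sum, Finset.sum_sub_distrib] at h4
    rw [Fin.sum_univ_succ]
    have h5 : ∑ i : Fin k, ∑ z : Fin (k + 1) → F, min (f z) (f (z + Pi.single i.succ g)) =
        ∑ c, ∑ i : Fin k, ∑ z,
          min (f (Fin.cons c z)) (f (Fin.cons c (z + Pi.single i g))) := by
      refine Eq.trans ?_ Finset.sum_comm
      refine Finset.sum_congr rfl fun i _ => ?_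
      rw [hsplit]
      simp_rw [hsucc]
    have hlog : 0 ≤ Real.log 2 := Real.log_nonneg (by norm_num)
    have h6 := mul_le_mul_of_nonneg_left h2 hlog
    rw [mul_add, h5, hsplit f, hsplit fun z => f z * Real.log (f z)]
    linarith

/-- The entropy of a weight is at most the logarithm of the size of any set that supports it. The
additive `1` keeps the proof to `log x ≤ x - 1`. -/
theorem entropy_le_log_card {α : Type*} [Fintype α] (f : α → ℝ) (hf : ∀ z, 0 ≤ f z)
    (s : Finset α) (hs : ∀ z, z ∉ s → f z = 0) {K : ℝ} (hK : 0 < K) (hsK : (s.card : ℝ) ≤ K) :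
    (∑ z, f z) * Real.log (∑ z, f z) - ∑ z, f z * Real.log (f z) ≤
      (∑ z, f z) * (Real.log K + 1) := by
  set T := ∑ z, f z with hT
  have hT0 : 0 ≤ T := Finset.sum_nonneg fun z _ => hf z
  have hterm : ∀ z, f z * (Real.log T - Real.log (f z) - Real.log K) ≤ T / K := by
    intro z
    rcases (hf z).eq_or_lt with h | h
    · rw [← h]; simpa using div_nonneg hT0 hK.le
    · have hTp : 0 < T := h.trans_le (Finset.single_le_sum (fun z _ => hf z) (Finset.mem_univ z))
      have h1 : Real.log T - Real.log (f z) - Real.log K = Real.log (T / f z / K) := by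
        rw [Real.log_div (by positivity) hK.ne', Real.log_div hTp.ne' h.ne']
      rw [h1]
      calc f z * Real.log (T / f z / K) ≤ f z * (T / f z / K) := by
            gcongr
            exact Real.log_le_self (by positivity)
        _ = T / K := by field_simp
  have hsum : ∑ z, f z * (Real.log T - Real.log (f z) - Real.log K) ≤ T := by
    calc ∑ z, f z * (Real.log T - Real.log (f z) - Real.log K)
        = ∑ z ∈ s, f z * (Real.log T - Real.log (f z) - Real.log K) := by
          symm
          refine Finset.sum_subset (Finset.subset_univ _) fun z _ hz => ?_
          rw [hs z hz, zero_mul]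
      _ ≤ ∑ z ∈ s, T / K := Finset.sum_le_sum fun z _ => hterm z
      _ = s.card * (T / K) := by simp
      _ ≤ K * (T / K) := by gcongr
      _ = T := by field_simp
  have : ∑ z, f z * (Real.log T - Real.log (f z) - Real.log K) =
      T * Real.log T - ∑ z, f z * Real.log (f z) - T * Real.log K := by
    simp_rw [mul_sub]
    rw [Finset.sum_sub_distrib, Finset.sum_sub_distrib, ← Finset.sum_mul, ← Finset.sum_mul]
  linarith

/-! ### One step of a walk -/

/-- One step of a walk that replaces one token of a block. From the state `v`, the move `t` deletes
the token `A v t` at some position `p` of the block `P.1`, writes `Bf v t` there, and continues from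
the state `C v t` with the kernel `M` on the remaining blocks. -/
noncomputable def stepKernel {W X Y : Type*} {h m : ℕ} (A Bf C : W → Fin m → W)
    (M : W → X → Y → ℝ) (v : W) (P : (Fin h → W) × X) (Q : (Fin h → W) × Y) : ℝ :=
  open Classical in
  ∑ p, ∑ t, if P.1 p = A v t ∧ Q.1 = Function.update P.1 p (Bf v t) then M (C v t) P.2 Q.2 else 0

section StepKernel

variable {W X Y : Type*} {h m : ℕ} (A Bf C : W → Fin m → W) (M : W → X → Y → ℝ) (v : W)

theorem stepKernel_nonneg (hM : ∀ v x y, 0 ≤ M v x y) (P : (Fin h → W) × X)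
    (Q : (Fin h → W) × Y) : 0 ≤ stepKernel A Bf C M v P Q :=
  Finset.sum_nonneg fun p _ => Finset.sum_nonneg fun t _ => by
    split_ifs; exacts [hM _ _ _, le_rfl]

/-- A step read backwards is a step with the two token maps exchanged. -/
theorem stepKernel_swap (P : (Fin h → W) × X) (Q : (Fin h → W) × Y) :
    stepKernel A Bf C M v P Q = stepKernel Bf A C (fun v y x => M v x y) v Q P := by
  classical
  unfold stepKernel
  refine Finset.sum_congr rfl fun p _ => Finset.sum_congr rfl fun t _ => ?_
  refine if_congr ⟨?_, ?_⟩ rfl rfl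
  · rintro ⟨h1, h2⟩
    rw [h2]
    simp [← h1]
  · rintro ⟨h1, h2⟩
    rw [h2]
    simp [← h1]

theorem sum_stepKernel [Fintype W] [Fintype Y] (P : (Fin h → W) × X) :
    ∑ Q, stepKernel A Bf C M v P Q =
      ∑ p, fiberSum (A v) (fun t => ∑ y, M (C v t) P.2 y) (P.1 p) := by
  classical
  unfold stepKernel fiberSum
  rw [Finset.sum_comm]
  refine Finset.sum_congr rfl fun p _ => ?_
  rw [Finset.sum_comm]
  refine Finset.sum_congr rfl fun t _ => ?_
  rw [Fintype.sum_prod_type_right]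
  by_cases h1 : P.1 p = A v t <;> simp [h1]

theorem sum_stepKernel_right [Fintype W] [Fintype X] (Q : (Fin h → W) × Y) :
    ∑ P, stepKernel A Bf C M v P Q =
      ∑ p, fiberSum (Bf v) (fun t => ∑ x, M (C v t) x Q.2) (Q.1 p) := by
  simp_rw [stepKernel_swap A Bf C M v]
  exact sum_stepKernel Bf A C _ v Q

theorem card_mul_sum_sum_stepKernel [Fintype W] [Fintype X] [Fintype Y] :
    (Fintype.card W : ℝ) * ∑ P : (Fin h → W) × X, ∑ Q, stepKernel A Bf C M v P Q =
      (Fintype.card W : ℝ) ^ h * (h * ∑ t, ∑ x, ∑ y, M (C v t) x y) := by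
  simp_rw [sum_stepKernel]
  rw [Fintype.sum_prod_type_right]
  simp only
  have h1 : ∀ x : X, (Fintype.card W : ℝ) *
      ∑ B : Fin h → W, ∑ p, fiberSum (A v) (fun t => ∑ y, M (C v t) x y) (B p) =
      (Fintype.card W : ℝ) ^ h * (h * ∑ t, ∑ y, M (C v t) x y) := by
    intro x
    rw [Finset.sum_comm, Finset.mul_sum]
    simp_rw [sum_pi_eval, sum_fiberSum]
    simp
    ring
  rw [Finset.mul_sum]
  simp_rw [h1]
  rw [← Finset.mul_sum, ← Finset.mul_sum, Finset.sum_comm]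

end StepKernel

/-! ### Systems of walks -/

/-- The words read and the words written by walks of length `j`, each made of `j` blocks of `h`
tokens (elements of `W`), with the weight `M v x y` of the walks that start at `v`, turn the word
`y` into `x` and have their final state recorded in `x`. The parameter `ρ` is the proportion of
tokens available at a state, `ε` the relative error allowed in each block, and `η` the proportion
of walks lost in each block. -/
structure WalkSystem {W : Type u} [Fintype W] {Γ : Type*} [AddCommGroup Γ] (φ : W → Γ)
    (h : ℕ) (ρ ε η : ℝ) (j : ℕ) where
  /-- The words read, together with a final state. -/
  X : Type u
  /-- The words written. -/
  Y : Type u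
  fintypeX : Fintype X
  fintypeY : Fintype Y
  /-- The vector that a word read represents. -/
  posX : X → Γ
  /-- The vector that a word written represents. -/
  posY : Y → Γ
  /-- The weight of the walks from a given state between two words. -/
  M : W → X → Y → ℝ
  /-- A bound on the weight at a word that is uniform in the starting state. -/
  a : X → ℝ
  M_nonneg : ∀ v x y, 0 ≤ M v x y
  a_nonneg : ∀ x, 0 ≤ a x
  pos_eq : ∀ v x y, M v x y ≠ 0 → posX x = posY y + φ v
  cardX : (Fintype.card X : ℝ) = Fintype.card W * (Fintype.card W : ℝ) ^ (h * j)
  cardY : (Fintype.card Y : ℝ) = (Fintype.card W : ℝ) ^ (h * j)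
  sum_left_le : ∀ v x, ∑ y, M v x y ≤ a x
  sum_right_le : ∀ v y, ∑ x, M v x y ≤ (1 + ε) ^ j
  sum_a_le : ∑ x, a x ≤ (Fintype.card W / 2 ^ j + 6 / ρ) * (Fintype.card W : ℝ) ^ (h * j)
  total_le : ∀ v, ∑ x, ∑ y, M v x y ≤ (Fintype.card W : ℝ) ^ (h * j)
  le_total : ∀ v, (1 - j * η) * (Fintype.card W : ℝ) ^ (h * j) ≤ ∑ x, ∑ y, M v x y

attribute [instance] WalkSystem.fintypeX WalkSystem.fintypeY

/-- The walks of length zero. -/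
theorem WalkSystem.zero {W : Type u} [Fintype W] {Γ : Type*} [AddCommGroup Γ] (φ : W → Γ)
    (h : ℕ) {ρ : ℝ} (ε η : ℝ) (hρ : 0 < ρ) : Nonempty (WalkSystem φ h ρ ε η 0) := by
  classical
  exact ⟨{
    X := W
    Y := PUnit
    fintypeX := inferInstance
    fintypeY := inferInstance
    posX := φ
    posY := 0
    M := fun v x _ => if x = v then 1 else 0
    a := fun _ => 1
    M_nonneg := fun v x _ => by split_ifs <;> norm_num
    a_nonneg := fun _ => zero_le_one
    pos_eq := fun v x y hne => by
      have : x = v := by by_contra hx; simp [hx] at hne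
      simp [this]
    cardX := by simp
    cardY := by simp
    sum_left_le := fun v x => by simp; split_ifs <;> norm_num
    sum_right_le := fun v y => by simp
    sum_a_le := by simp; positivity
    total_le := fun v => by simp
    le_total := fun v => by simp }⟩

theorem card_filter_exists_le {α β : Type*} [Fintype α] [Fintype β] (P : β → α → Prop)
    [∀ b, DecidablePred (P b)] [DecidablePred fun a => ∃ b, P b a] {K : ℝ}
    (hK : ∀ b, ((Finset.univ.filter (P b)).card : ℝ) ≤ K) :
    ((Finset.univ.filter fun a => ∃ b, P b a).card : ℝ) ≤ Fintype.card β * K := by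
  classical
  have h1 : (Finset.univ.filter fun a => ∃ b, P b a) =
      Finset.univ.biUnion fun b => Finset.univ.filter (P b) := by
    ext; simp
  rw [h1]
  calc ((Finset.univ.biUnion fun b => Finset.univ.filter (P b)).card : ℝ)
      ≤ ∑ b, ((Finset.univ.filter (P b)).card : ℝ) := by exact_mod_cast Finset.card_biUnion_le
    _ ≤ ∑ _b : β, K := Finset.sum_le_sum fun b _ => hK b
    _ = _ := by simp

/-- For all but few blocks, a random token of the block moves every state to one where the weight
`g` is, on average, at most half of its maximum or a multiple of its mean. -/
theorem card_bad_left_le {W : Type*} [Fintype W] {h m : ℕ} {ρ ε : ℝ} (A C : W → Fin m → W)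
    (hA : ∀ v, Function.Injective (A v)) (hC : ∀ v, Function.Injective (C v))
    (hW : 0 < Fintype.card W) (hh : 0 < h) (hρ : 0 < ρ) (hε : 0 < ε) (hε1 : ε ≤ 1)
    (g : W → ℝ) {a : ℝ} (hg : ∀ w, 0 ≤ g w) (hga : ∀ w, g w ≤ a) (P : (Fin h → W) → Prop)
    [DecidablePred P]
    (hP : ∀ B, P B → ∃ v, 3 * ((∑ w, g w) / Fintype.card W) / ρ + a / 2 <
      (∑ p, fiberSum (A v) (fun t => g (C v t)) (B p)) / (h * ρ)) :
    ((Finset.univ.filter P).card : ℝ) ≤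
      Fintype.card W * ((Fintype.card W : ℝ) ^ h * Real.exp (-(h * ρ * ε ^ 2 / 4))) := by
  classical
  have hN : (0 : ℝ) < Fintype.card W := by exact_mod_cast hW
  have hhr : (0 : ℝ) < h := by exact_mod_cast hh
  have ha : 0 ≤ a := by
    obtain ⟨w⟩ := Fintype.card_pos_iff.1 hW
    exact (hg w).trans (hga w)
  have hsub : Finset.univ.filter P ⊆ Finset.univ.filter fun B : Fin h → W => ∃ v,
      3 * ((∑ w, g w) / Fintype.card W) / ρ + a / 2 <
      (∑ p, fiberSum (A v) (fun t => g (C v t)) (B p)) / (h * ρ) := by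
    intro B hB
    simp only [Finset.mem_filter, Finset.mem_univ, true_and] at hB ⊢
    exact hP B hB
  refine (Nat.cast_le.2 (Finset.card_le_card hsub)).trans ?_
  refine card_filter_exists_le _ fun v => ?_
  have hgs : 0 ≤ ∑ w, g w := Finset.sum_nonneg fun w _ => hg w
  rcases ha.eq_or_lt with ha0 | hapos
  · have hg0 : ∀ w, g w = 0 := fun w => le_antisymm (ha0 ▸ hga w) (hg w)
    have : (Finset.univ.filter fun B : Fin h → W =>
        3 * ((∑ w, g w) / Fintype.card W) / ρ + a / 2 <
        (∑ p, fiberSum (A v) (fun t => g (C v t)) (B p)) / (h * ρ)) = ∅ := by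
      refine Finset.filter_eq_empty_iff.2 fun B _ => ?_
      simp [hg0, ← ha0, fiberSum]
    rw [this]
    simp
    positivity
  · set μ := (∑ w, g w) / (Fintype.card W * a) with hμ
    have hμ0 : 0 ≤ μ := by positivity
    refine (card_filter_sum_gt_le (μ := μ) (lam := 1) (τ := h * (3 * μ + ρ / 2))
      (fun w => fiberSum (A v) (fun t => g (C v t)) w * a⁻¹)
      (fun w => mul_nonneg (fiberSum_nonneg _ (fun t => hg _) w) (inv_nonneg.2 ha)) ?_ ?_
      zero_le_one _ ?_).trans ?_
    · intro w
      rw [← div_eq_mul_inv, div_le_one hapos]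
      exact fiberSum_le (hA v) ha (fun t => hga _) w
    · rw [← Finset.sum_mul, sum_fiberSum, hμ]
      have h1 : ∑ t, g (C v t) ≤ ∑ w, g w := by
        rw [← Finset.sum_image (f := g) (g := C v) (s := Finset.univ) (fun x _ y _ hxy => hC v hxy)]
        exact Finset.sum_le_sum_of_subset_of_nonneg (Finset.subset_univ _) fun w _ _ => hg w
      calc (∑ t, g (C v t)) * a⁻¹ ≤ (∑ w, g w) * a⁻¹ := by gcongr
        _ = _ := by field_simp
    · intro B hB
      rw [lt_div_iff₀ (by positivity)] at hB
      rw [← Finset.sum_mul, ← div_eq_mul_inv, le_div_iff₀ hapos, hμ]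
      refine le_trans (le_of_eq ?_) hB.le
      field_simp
    · have he : Real.exp 1 < 4 := Real.exp_one_lt_d9.trans (by norm_num)
      gcongr
      have h1 : μ * (Real.exp 1 - 1) ≤ μ * 3 := by gcongr; linarith
      have h2 : (h : ℝ) * (μ * (Real.exp 1 - 1)) ≤ h * (μ * 3) := by gcongr
      have h3 : h * ρ * ε ^ 2 ≤ h * ρ * 1 := by
        gcongr
        exact pow_le_one₀ hε.le hε1
      have h4 : 0 < h * ρ := by positivity
      linarith

/-- For all but few blocks, the number of positions of the block whose token is available is at most
`1 + ε` times its mean, for every state. -/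
theorem card_bad_right_le {W : Type*} [Fintype W] {h m : ℕ} {ρ ε : ℝ} (Bf : W → Fin m → W)
    (hB : ∀ v, Function.Injective (Bf v)) (hρN : ρ * Fintype.card W = m) (hρ : 0 < ρ)
    (hε : 0 < ε) (hε1 : ε ≤ 1) (P : (Fin h → W) → Prop) [DecidablePred P]
    (hP : ∀ B, P B → ∃ v, (1 + ε) * (h * ρ) < ∑ p, fiberSum (Bf v) (fun _ => 1) (B p)) :
    ((Finset.univ.filter P).card : ℝ) ≤
      Fintype.card W * ((Fintype.card W : ℝ) ^ h * Real.exp (-(h * ρ * ε ^ 2 / 4))) := by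
  classical
  have hsub : Finset.univ.filter P ⊆ Finset.univ.filter fun B : Fin h → W => ∃ v,
      (1 + ε) * (h * ρ) < ∑ p, fiberSum (Bf v) (fun _ => 1) (B p) := by
    intro B hB
    simp only [Finset.mem_filter, Finset.mem_univ, true_and] at hB ⊢
    exact hP B hB
  refine (Nat.cast_le.2 (Finset.card_le_card hsub)).trans ?_
  refine card_filter_exists_le _ fun v => ?_
  refine (card_filter_sum_gt_le (μ := ρ) (lam := ε / 2) (τ := (1 + ε) * (h * ρ))
    (fun w => fiberSum (Bf v) (fun _ => 1) w)
    (fun w => fiberSum_nonneg _ (fun _ => zero_le_one) w)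
    (fun w => fiberSum_le (hB v) zero_le_one (fun _ => le_rfl) w) ?_ (by positivity) _
    (fun B hB => hB.le)).trans ?_
  · rw [sum_fiberSum, hρN]
    simp
  · gcongr
    have h1 := (abs_le.1 (Real.abs_exp_sub_one_sub_id_le (x := ε / 2)
      (by rw [abs_of_pos (by positivity)]; linarith))).2
    have h2 : (h : ℝ) * (ρ * (Real.exp (ε / 2) - 1)) ≤ h * (ρ * (ε / 2 + (ε / 2) ^ 2)) := by
      gcongr
      linarith
    nlinarith

/-- The kernel of walks extended by one block, restricted to the words whose new block is good. -/
noncomputable def goodStepKernel {W X Y : Type*} {h m : ℕ} (ρ : ℝ) (A Bf C : W → Fin m → W)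
    (M : W → X → Y → ℝ) (good : (Fin h → W) × X → Prop) (good' : (Fin h → W) → Prop) (v : W)
    (P : (Fin h → W) × X) (Q : (Fin h → W) × Y) : ℝ :=
  open Classical in
  if good P ∧ good' Q.1 then stepKernel A Bf C M v P Q / (h * ρ) else 0

section GoodStep

variable {W : Type u} {Γ : Type*} [AddCommGroup Γ] {φ : W → Γ} {h m : ℕ} {ρ ε η : ℝ}
  {j : ℕ}

theorem goodStepKernel_nonneg {X Y : Type*} (hρ : 0 < ρ) (A Bf C : W → Fin m → W)
    {M : W → X → Y → ℝ} (hM : ∀ v x y, 0 ≤ M v x y) (good : (Fin h → W) × X → Prop)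
    (good' : (Fin h → W) → Prop) (v : W) (P : (Fin h → W) × X) (Q : (Fin h → W) × Y) :
    0 ≤ goodStepKernel ρ A Bf C M good good' v P Q := by
  unfold goodStepKernel
  split_ifs
  · exact div_nonneg (stepKernel_nonneg A Bf C M v hM P Q) (by positivity)
  · exact le_rfl

theorem goodStepKernel_le {X Y : Type*} (hρ : 0 < ρ) (A Bf C : W → Fin m → W)
    {M : W → X → Y → ℝ} (hM : ∀ v x y, 0 ≤ M v x y) (good : (Fin h → W) × X → Prop)
    (good' : (Fin h → W) → Prop) (v : W) (P : (Fin h → W) × X) (Q : (Fin h → W) × Y) :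
    goodStepKernel ρ A Bf C M good good' v P Q ≤ stepKernel A Bf C M v P Q / (h * ρ) := by
  unfold goodStepKernel
  split_ifs
  · exact le_rfl
  · exact div_nonneg (stepKernel_nonneg A Bf C M v hM P Q) (by positivity)

theorem le_goodStepKernel {X Y : Type*} (hρ : 0 < ρ) (A Bf C : W → Fin m → W)
    {M : W → X → Y → ℝ} (hM : ∀ v x y, 0 ≤ M v x y) (good : (Fin h → W) × X → Prop)
    (good' : (Fin h → W) → Prop) [DecidablePred good] [DecidablePred good'] (v : W)
    (P : (Fin h → W) × X) (Q : (Fin h → W) × Y) :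
    (stepKernel A Bf C M v P Q - (if good P then 0 else stepKernel A Bf C M v P Q) -
      (if good' Q.1 then 0 else stepKernel A Bf C M v P Q)) / (h * ρ) ≤
    goodStepKernel ρ A Bf C M good good' v P Q := by
  have h0 := stepKernel_nonneg A Bf C M v hM P Q
  have h1 : (0 : ℝ) ≤ h * ρ := by positivity
  unfold goodStepKernel
  by_cases hP : good P <;> by_cases hQ : good' Q.1 <;> simp [hP, hQ]
  exact div_nonpos_of_nonpos_of_nonneg (by linarith) h1

/-- Positions telescope along a step. -/
theorem pos_eq_of_stepKernel_ne_zero {X Y : Type*} (A Bf C : W → Fin m → W)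
    (hrel : ∀ s t, φ s = φ (A s t) - φ (Bf s t) + φ (C s t)) {M : W → X → Y → ℝ}
    {posX : X → Γ} {posY : Y → Γ} (hpos : ∀ v x y, M v x y ≠ 0 → posX x = posY y + φ v) (v : W)
    (P : (Fin h → W) × X) (Q : (Fin h → W) × Y) (hne : stepKernel A Bf C M v P Q ≠ 0) :
    ∑ p, φ (P.1 p) + posX P.2 = ∑ p, φ (Q.1 p) + posY Q.2 + φ v := by
  classical
  unfold stepKernel at hne
  obtain ⟨p, -, hp⟩ := Finset.exists_ne_zero_of_sum_ne_zero hne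
  obtain ⟨t, -, ht⟩ := Finset.exists_ne_zero_of_sum_ne_zero hp
  rw [ite_ne_right_iff] at ht
  obtain ⟨⟨h1, h2⟩, h3⟩ := ht
  rw [hpos _ _ _ h3, h2, hrel v t, ← Finset.add_sum_erase _ _ (Finset.mem_univ p),
    ← Finset.add_sum_erase Finset.univ (fun q => φ (Function.update P.1 p (Bf v t) q))
      (Finset.mem_univ p)]
  have h4 : ∑ q ∈ Finset.univ.erase p, φ (Function.update P.1 p (Bf v t) q) =
      ∑ q ∈ Finset.univ.erase p, φ (P.1 q) :=
    Finset.sum_congr rfl fun q hq => by rw [Function.update_of_ne (Finset.ne_of_mem_erase hq)]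
  rw [h4, Function.update_self, h1]
  abel

theorem sum_fiberSum_le {α : Fin m → W} (hα : Function.Injective α) {q : Fin m → ℝ} {a : ℝ}
    (ha : 0 ≤ a) (hq : ∀ t, q t ≤ a) (B : Fin h → W) : ∑ p, fiberSum α q (B p) ≤ h * a :=
  (Finset.sum_le_sum fun p _ => fiberSum_le hα ha hq (B p)).trans (by simp)

variable [Fintype W]

/-- Walks extend by one block. -/
theorem WalkSystem.succ (A Bf C : W → Fin m → W) (hA : ∀ v, Function.Injective (A v))
    (hB : ∀ v, Function.Injective (Bf v)) (hC : ∀ v, Function.Injective (C v))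
    (hrel : ∀ s t, φ s = φ (A s t) - φ (Bf s t) + φ (C s t))
    (hW : 0 < Fintype.card W) (hh : 0 < h) (hm : 0 < m) (hρN : ρ * Fintype.card W = m)
    (hε : 0 < ε) (hε1 : ε ≤ 1)
    (hη : 8 * (Fintype.card W : ℝ) ^ 2 / ρ * Real.exp (-(h * ρ * ε ^ 2 / 4)) ≤ η)
    (S : WalkSystem φ h ρ ε η j) : Nonempty (WalkSystem φ h ρ ε η (j + 1)) := by
  classical
  have hN : (0 : ℝ) < Fintype.card W := by exact_mod_cast hW
  have hhr : (0 : ℝ) < h := by exact_mod_cast hh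
  have hmr : (1 : ℝ) ≤ m := by exact_mod_cast hm
  have hρ : 0 < ρ := by
    by_contra hcon
    nlinarith [mul_nonneg (neg_nonneg.2 (not_lt.1 hcon)) hN.le]
  have hhρ : 0 < h * ρ := by positivity
  obtain ⟨X, Y, _, _, posX, posY, M, a, M0, a0, hpos, cX, cY, hl, hr, ha, ht, hlt⟩ := S
  set N : ℝ := ((Fintype.card W : ℕ) : ℝ) with hNdef
  have hN1 : 1 ≤ N := by rw [hNdef]; exact_mod_cast hW
  set a' : (Fin h → W) × X → ℝ := fun P =>
    3 * ((∑ w, ∑ y, M w P.2 y) / N) / ρ + a P.2 / 2 with ha'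
  have a'0 : ∀ P, 0 ≤ a' P := fun P => by
    have := a0 P.2
    have : 0 ≤ ∑ w, ∑ y, M w P.2 y :=
      Finset.sum_nonneg fun w _ => Finset.sum_nonneg fun y _ => M0 _ _ _
    positivity
  set good : (Fin h → W) × X → Prop := fun P => ∀ v,
    (∑ p, fiberSum (A v) (fun t => ∑ y, M (C v t) P.2 y) (P.1 p)) / (h * ρ) ≤ a' P with hgood
  set good' : (Fin h → W) → Prop := fun B => ∀ v,
    ∑ p, fiberSum (Bf v) (fun _ => 1) (B p) ≤ (1 + ε) * (h * ρ) with hgood'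
  set β : ℝ := N * (N ^ h * Real.exp (-(h * ρ * ε ^ 2 / 4))) with hβ
  have hβ0 : 0 ≤ β := by positivity
  have hbad : ∀ x, ((Finset.univ.filter fun B => ¬ good (B, x)).card : ℝ) ≤ β := fun x =>
    card_bad_left_le A C hA hC hW hh hρ hε hε1 (fun w => ∑ y, M w x y)
      (fun w => Finset.sum_nonneg fun y _ => M0 _ _ _) (fun w => hl w x) _
      (fun B hB => by
        simp only [hgood, not_forall, not_le] at hB
        exact hB)
  have hbad' : ((Finset.univ.filter fun B => ¬ good' B).card : ℝ) ≤ β :=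
    card_bad_right_le Bf hB hρN hρ hε hε1 _
      (fun B hB => by
        simp only [hgood', not_forall, not_le] at hB
        exact hB)
  have hpow : N ^ (h * (j + 1)) = N ^ h * N ^ (h * j) := by rw [← pow_add]; ring_nf
  have hK : ∀ v, N * ∑ P : (Fin h → W) × X, ∑ Q : (Fin h → W) × Y, stepKernel A Bf C M v P Q =
      N ^ h * (h * ∑ t, ∑ x, ∑ y, M (C v t) x y) := fun v =>
    card_mul_sum_sum_stepKernel A Bf C M v
  -- Converts the normalization of `hK` into the one of `goodStepKernel`.
  have hscale : ∀ s : ℝ, N ^ h * (h * (m * s)) / N / (h * ρ) = N ^ h * s := by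
    intro s
    rw [← hρN]
    field_simp
  refine ⟨{
    X := (Fin h → W) × X
    Y := (Fin h → W) × Y
    fintypeX := inferInstance
    fintypeY := inferInstance
    posX := fun P => ∑ p, φ (P.1 p) + posX P.2
    posY := fun Q => ∑ p, φ (Q.1 p) + posY Q.2
    M := goodStepKernel ρ A Bf C M good good'
    a := a'
    M_nonneg := goodStepKernel_nonneg hρ A Bf C M0 good good'
    a_nonneg := a'0
    pos_eq := ?_
    cardX := ?_
    cardY := ?_
    sum_left_le := ?_
    sum_right_le := ?_
    sum_a_le := ?_
    total_le := ?_
    le_total := ?_ }⟩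
  · intro v P Q hne
    refine pos_eq_of_stepKernel_ne_zero A Bf C hrel hpos v P Q fun h0 => hne ?_
    unfold goodStepKernel
    simp [h0]
  · rw [Fintype.card_prod, Nat.cast_mul, cX, hpow, Fintype.card_fun, Fintype.card_fin]
    push_cast
    ring
  · rw [Fintype.card_prod, Nat.cast_mul, cY, hpow, Fintype.card_fun, Fintype.card_fin]
    push_cast
    ring
  · intro v P
    by_cases hP : good P
    · refine le_trans ?_ (hP v)
      rw [← sum_stepKernel A Bf C M v P, Finset.sum_div]
      exact Finset.sum_le_sum fun Q _ => goodStepKernel_le hρ A Bf C M0 good good' v P Q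
    · simp [goodStepKernel, hP, a'0]
  · intro v Q
    by_cases hQ : good' Q.1
    · have hε' : 0 ≤ (1 + ε) ^ j := by positivity
      calc ∑ P, goodStepKernel ρ A Bf C M good good' v P Q
          ≤ ∑ P, stepKernel A Bf C M v P Q / (h * ρ) :=
            Finset.sum_le_sum fun P _ => goodStepKernel_le hρ A Bf C M0 good good' v P Q
        _ = (∑ p, fiberSum (Bf v) (fun t => ∑ x, M (C v t) x Q.2) (Q.1 p)) / (h * ρ) := by
            rw [← Finset.sum_div, sum_stepKernel_right]
        _ ≤ (∑ p, fiberSum (Bf v) (fun _ => 1 * (1 + ε) ^ j) (Q.1 p)) / (h * ρ) := by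
            gcongr with p
            refine fiberSum_mono _ (fun t => ?_) _
            rw [one_mul]
            exact hr _ _
        _ = (∑ p, fiberSum (Bf v) (fun _ => 1) (Q.1 p)) * (1 + ε) ^ j / (h * ρ) := by
            simp_rw [fiberSum_mul_const (Bf v) (fun _ => 1) ((1 + ε) ^ j)]
            rw [Finset.sum_mul]
        _ ≤ ((1 + ε) * (h * ρ)) * (1 + ε) ^ j / (h * ρ) := by
            gcongr
            exact hQ v
        _ = (1 + ε) ^ (j + 1) := by
            rw [pow_succ]
            field_simp
    · simp [goodStepKernel, hQ]
      positivity
  · have h1 : ∑ x, (∑ w, ∑ y, M w x y) / N ≤ N ^ (h * j) := by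
      rw [← Finset.sum_div, Finset.sum_comm, div_le_iff₀ hN]
      calc ∑ w, ∑ x, ∑ y, M w x y ≤ ∑ _w : W, N ^ (h * j) := Finset.sum_le_sum fun w _ => ht w
        _ = _ := by simp [hNdef, mul_comm]
    rw [Fintype.sum_prod_type, ha', hpow]
    simp only [Finset.sum_const, Finset.card_univ, nsmul_eq_mul, Fintype.card_fun,
      Fintype.card_fin, Nat.cast_pow]
    rw [← hNdef, mul_left_comm]
    gcongr
    rw [Finset.sum_add_distrib, ← Finset.sum_div, ← Finset.sum_div, ← Finset.mul_sum]
    calc 3 * (∑ x, (∑ w, ∑ y, M w x y) / N) / ρ + (∑ x, a x) / 2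
        ≤ 3 * N ^ (h * j) / ρ + (N / 2 ^ j + 6 / ρ) * N ^ (h * j) / 2 := by gcongr
      _ = _ := by field_simp; ring
  · intro v
    calc ∑ P, ∑ Q, goodStepKernel ρ A Bf C M good good' v P Q
        ≤ ∑ P, ∑ Q, stepKernel A Bf C M v P Q / (h * ρ) :=
          Finset.sum_le_sum fun P _ => Finset.sum_le_sum fun Q _ =>
            goodStepKernel_le hρ A Bf C M0 good good' v P Q
      _ = N ^ h * (h * ∑ t, ∑ x, ∑ y, M (C v t) x y) / N / (h * ρ) := by
          simp_rw [← Finset.sum_div]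
          rw [← hK v]
          field_simp
      _ ≤ N ^ h * (h * (m * N ^ (h * j))) / N / (h * ρ) := by
          gcongr
          calc _ ≤ ∑ _t : Fin m, N ^ (h * j) := Finset.sum_le_sum fun t _ => ht _
            _ = _ := by simp
      _ = _ := by rw [hscale, hpow]
  · intro v
    -- The weight lost to bad blocks of the word read, by the bound `a`.
    have hloss : ∑ P : (Fin h → W) × X, ∑ Q : (Fin h → W) × Y,
        (if good P then 0 else stepKernel A Bf C M v P Q) ≤
        h * β * ((N / 2 ^ j + 6 / ρ) * N ^ (h * j)) := by
      have h1 : ∀ P : (Fin h → W) × X, ∑ Q : (Fin h → W) × Y,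
          (if good P then 0 else stepKernel A Bf C M v P Q) ≤
          if good P then 0 else h * a P.2 := by
        intro P
        split_ifs
        · simp
        · rw [sum_stepKernel]
          exact sum_fiberSum_le (hA v) (a0 _) (fun t => hl _ _) _
      calc _ ≤ ∑ P : (Fin h → W) × X, if good P then 0 else h * a P.2 :=
            Finset.sum_le_sum fun P _ => h1 P
        _ = ∑ x, ((Finset.univ.filter fun B => ¬ good (B, x)).card : ℝ) * (h * a x) := by
            rw [Fintype.sum_prod_type_right]
            refine Finset.sum_congr rfl fun x _ => ?_
            simp_rw [← ite_not (good _)]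
            rw [← Finset.sum_filter]
            simp
        _ ≤ ∑ x, β * (h * a x) := by
            refine Finset.sum_le_sum fun x _ => ?_
            have := a0 x
            have := hbad x
            gcongr
        _ = h * β * ∑ x, a x := by
            rw [Finset.mul_sum]
            exact Finset.sum_congr rfl fun x _ => by ring
        _ ≤ _ := by gcongr
    -- The weight lost to bad blocks of the word written, by the bound on the total weight.
    have hloss' : ∑ P : (Fin h → W) × X, ∑ Q : (Fin h → W) × Y,
        (if good' Q.1 then 0 else stepKernel A Bf C M v P Q) ≤ h * β * N ^ (h * j) := by
      have h1 : ∀ B, ∑ y, ∑ P : (Fin h → W) × X,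
          (if good' B then 0 else stepKernel A Bf C M v P (B, y)) ≤
          if good' B then 0 else h * N ^ (h * j) := by
        intro B
        split_ifs
        · simp
        · simp_rw [sum_stepKernel_right]
          rw [Finset.sum_comm]
          simp_rw [fiberSum_sum]
          refine sum_fiberSum_le (hB v) (by positivity) (fun t => ?_) _
          rw [Finset.sum_comm]
          exact ht _
      rw [Finset.sum_comm, Fintype.sum_prod_type]
      calc _ ≤ ∑ B : Fin h → W, if good' B then 0 else h * N ^ (h * j) :=
            Finset.sum_le_sum fun B _ => h1 B
        _ = ((Finset.univ.filter fun B => ¬ good' B).card : ℝ) * (h * N ^ (h * j)) := by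
            simp_rw [← ite_not (good' _)]
            rw [← Finset.sum_filter]
            simp
        _ ≤ β * (h * N ^ (h * j)) := by gcongr
        _ = _ := by ring
    have hmain : (1 - j * η) * N ^ (h * (j + 1)) ≤
        (∑ P : (Fin h → W) × X, ∑ Q : (Fin h → W) × Y, stepKernel A Bf C M v P Q) / (h * ρ) := by
      calc (1 - j * η) * N ^ (h * (j + 1))
          = N ^ h * (h * (m * ((1 - j * η) * N ^ (h * j)))) / N / (h * ρ) := by
            rw [hscale, hpow]; ring
        _ ≤ N ^ h * (h * ∑ t, ∑ x, ∑ y, M (C v t) x y) / N / (h * ρ) := by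
            gcongr
            calc _ = ∑ _t : Fin m, (1 - j * η) * N ^ (h * j) := by simp
              _ ≤ _ := Finset.sum_le_sum fun t _ => hlt _
        _ = _ := by
            rw [← hK v]
            field_simp
    have hβη : (h * β * ((N / 2 ^ j + 6 / ρ) * N ^ (h * j)) + h * β * N ^ (h * j)) / (h * ρ) ≤
        η * N ^ (h * (j + 1)) := by
      have h1 : N / 2 ^ j ≤ N := div_le_self hN.le (one_le_pow₀ (by norm_num))
      have h2 : 6 / ρ ≤ 6 * N := by
        rw [div_le_iff₀ hρ]
        nlinarith
      calc _ = N * Real.exp (-(h * ρ * ε ^ 2 / 4)) / ρ * (N / 2 ^ j + 6 / ρ + 1) *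
            N ^ (h * (j + 1)) := by
            rw [hβ, hpow]; field_simp
        _ ≤ N * Real.exp (-(h * ρ * ε ^ 2 / 4)) / ρ * (8 * N) * N ^ (h * (j + 1)) := by
            gcongr
            linarith
        _ = 8 * N ^ 2 / ρ * Real.exp (-(h * ρ * ε ^ 2 / 4)) * N ^ (h * (j + 1)) := by ring
        _ ≤ _ := by gcongr
    have hsum := Finset.sum_le_sum fun P (_ : P ∈ (Finset.univ : Finset ((Fin h → W) × X))) =>
      Finset.sum_le_sum fun Q (_ : Q ∈ (Finset.univ : Finset ((Fin h → W) × Y))) =>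
        le_goodStepKernel hρ A Bf C M0 good good' v P Q
    refine le_trans ?_ hsum
    simp_rw [← Finset.sum_div, Finset.sum_sub_distrib]
    rw [sub_div, sub_div]
    have h3 := div_le_div_of_nonneg_right (add_le_add hloss hloss') hhρ.le
    rw [add_div] at h3
    push_cast
    linarith

theorem nonempty_walkSystem (φ : W → Γ) (A Bf C : W → Fin m → W)
    (hA : ∀ v, Function.Injective (A v))
    (hB : ∀ v, Function.Injective (Bf v)) (hC : ∀ v, Function.Injective (C v))
    (hrel : ∀ s t, φ s = φ (A s t) - φ (Bf s t) + φ (C s t))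
    (hW : 0 < Fintype.card W) (hh : 0 < h) (hm : 0 < m) (hρ : 0 < ρ)
    (hρN : ρ * Fintype.card W = m) (hε : 0 < ε) (hε1 : ε ≤ 1)
    (hη : 8 * (Fintype.card W : ℝ) ^ 2 / ρ * Real.exp (-(h * ρ * ε ^ 2 / 4)) ≤ η) (j : ℕ) :
    Nonempty (WalkSystem φ h ρ ε η j) := by
  induction j with
  | zero => exact WalkSystem.zero φ h ε η hρ
  | succ j ih =>
    obtain ⟨S⟩ := ih
    exact S.succ A Bf C hA hB hC hrel hW hh hm hρN hε hε1 hη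

end GoodStep

/-! ### The bound on the dimension -/

/-- Weights of the two sides that dominate, for every coordinate `i`, a coupling `M i` along edges
of direction `i` force the dimension to be at most logarithmic in the number of words. -/
theorem dimension_mul_le {F : Type*} [AddCommGroup F] [Fintype F] (g : F) (hg : g ≠ 0) {k : ℕ}
    {X Y : Type*} [Fintype X] [Fintype Y] (posX : X → Fin k → F) (posY : Y → Fin k → F)
    (M : Fin k → X → Y → ℝ) (a : X → ℝ) (b c : ℝ) (hM : ∀ i x y, 0 ≤ M i x y)
    (ha : ∀ x, 0 ≤ a x) (hb : 0 ≤ b)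
    (hpos : ∀ i x y, M i x y ≠ 0 → posX x = posY y + Pi.single i g)
    (hl : ∀ i x, ∑ y, M i x y ≤ a x) (hr : ∀ i y, ∑ x, M i x y ≤ b)
    (hc : ∀ i, c ≤ ∑ x, ∑ y, M i x y) (hX : 0 < Fintype.card X) :
    Real.log 2 * (k * c) ≤ 2 * ((∑ x, a x + Fintype.card Y * b) *
      (Real.log (Fintype.card X + Fintype.card Y) + 1)) := by
  classical
  set f : (Fin k → F) → ℝ := fun z =>
    ∑ x, (if posX x = z then a x else 0) + ∑ y, (if posY y = z then b else 0) with hf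
  have h1 : ∀ z, 0 ≤ ∑ x, (if posX x = z then a x else 0) := fun z =>
    Finset.sum_nonneg fun x _ => by split_ifs; exacts [ha x, le_rfl]
  have h2 : ∀ z, 0 ≤ ∑ y, (if posY y = z then b else 0) := fun z =>
    Finset.sum_nonneg fun x _ => by split_ifs; exacts [hb, le_rfl]
  have hf0 : ∀ z, 0 ≤ f z := fun z => add_nonneg (h1 z) (h2 z)
  have hT : ∑ z, f z = ∑ x, a x + Fintype.card Y * b := by
    rw [hf, Finset.sum_add_distrib]
    congr 1
    · rw [Finset.sum_comm]; simp
    · rw [Finset.sum_comm]; simp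
  have hcK : ∀ i, c ≤ ∑ z, min (f z) (f (z + Pi.single i g)) := by
    intro i
    refine (hc i).trans ?_
    have h3 : ∑ x, ∑ y, M i x y = ∑ z, ∑ y, if posY y = z then ∑ x, M i x y else 0 := by
      rw [Finset.sum_comm (s := Finset.univ (α := Fin k → F)), Finset.sum_comm]; simp
    rw [h3]
    refine Finset.sum_le_sum fun z _ => le_min ?_ ?_
    · refine le_trans ?_ (le_add_of_nonneg_left (h1 z))
      refine Finset.sum_le_sum fun y _ => ?_
      split_ifs
      exacts [hr i y, le_rfl]
    · refine le_trans ?_ (le_add_of_nonneg_right (h2 _))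
      calc ∑ y, (if posY y = z then ∑ x, M i x y else 0)
          = ∑ x, ∑ y, if posY y = z then M i x y else 0 := by
            rw [Finset.sum_comm]
            refine Finset.sum_congr rfl fun y _ => ?_
            split_ifs <;> simp
        _ ≤ ∑ x, if posX x = z + Pi.single i g then a x else 0 := by
            refine Finset.sum_le_sum fun x _ => ?_
            split_ifs with hx
            · refine le_trans (Finset.sum_le_sum fun y _ => ?_) (hl i x)
              split_ifs
              exacts [le_rfl, hM i x y]
            · refine (Finset.sum_eq_zero fun y _ => ?_).le
              split_ifs with hy
              · by_contra hne
                exact hx (by rw [hpos i x y hne, hy])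
              · rfl
  have hiso := log_two_mul_sum_sum_min_le g hg k f hf0
  have hent := entropy_le_log_card f hf0 (Finset.univ.image posX ∪ Finset.univ.image posY)
    (fun z hz => by
      simp only [Finset.mem_union, Finset.mem_image, Finset.mem_univ, true_and, not_or,
        not_exists] at hz
      simp [hf, hz.1, hz.2])
    (K := Fintype.card X + Fintype.card Y) (by positivity)
    (by
      have := (Finset.card_union_le (Finset.univ.image posX) (Finset.univ.image posY)).trans
        (add_le_add Finset.card_image_le Finset.card_image_le)
      exact_mod_cast this)
  rw [hT] at hent hiso
  have hk : k * c ≤ ∑ i : Fin k, ∑ z, min (f z) (f (z + Pi.single i g)) :=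
    le_trans (by simp) (Finset.sum_le_sum fun i _ => hcK i)
  have hlog : 0 ≤ Real.log 2 := Real.log_nonneg (by norm_num)
  linarith [mul_le_mul_of_nonneg_left hk hlog]

/-- A system of injective moves on `N` tokens that are attached to vectors of `F ^ k`, with a
proportion `m / N` of the tokens available at every state and with states at the multiples of the
standard basis, exists only if `k` is at most polylogarithmic in `N`. -/
theorem dimension_le_of_moves {F : Type*} [AddCommGroup F] [Fintype F] (g : F) (hg : g ≠ 0)
    {k m : ℕ} {W : Type u} [Fintype W] (φ : W → Fin k → F) (A Bf C : W → Fin m → W)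
    (hA : ∀ v, Function.Injective (A v)) (hB : ∀ v, Function.Injective (Bf v))
    (hC : ∀ v, Function.Injective (C v))
    (hrel : ∀ s t, φ s = φ (A s t) - φ (Bf s t) + φ (C s t))
    (hW : 2 ≤ Fintype.card W) (hm : 0 < m) (e : Fin k → W) (he : ∀ i, φ (e i) = Pi.single i g) :
    (k : ℝ) ≤ 300000 * Real.log (Fintype.card W) ^ 5 / (m / Fintype.card W) ^ 2 := by
  have hWpos : 0 < Fintype.card W := by omega
  set N : ℝ := ((Fintype.card W : ℕ) : ℝ) with hNdef
  have hN2 : (2 : ℝ) ≤ N := by rw [hNdef]; exact_mod_cast hW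
  have hN0 : 0 < N := by linarith
  set ρ : ℝ := m / N with hρdef
  have hm1 : (1 : ℝ) ≤ m := by exact_mod_cast hm
  have hρ : 0 < ρ := by positivity
  have hρN : ρ * N = m := by rw [hρdef]; field_simp
  have hρ1 : ρ ≤ 1 := by
    rw [hρdef, div_le_one hN0]
    obtain ⟨w⟩ := Fintype.card_pos_iff.1 hWpos
    have := Fintype.card_le_of_injective _ (hA w)
    rw [Fintype.card_fin] at this
    rw [hNdef]
    exact_mod_cast this
  set l := Real.log N with hl
  have hlog2 : 0.69 < Real.log 2 := lt_trans (by norm_num) Real.log_two_gt_d9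
  have hl0 : 0.69 < l := hlog2.trans_le (Real.log_le_log (by norm_num) hN2)
  have hlpos : 0 < l := by linarith
  -- The number of blocks makes the term `N / 2 ^ R` in the bound on the total of `a` at most `1`.
  set R := Nat.clog 2 (Fintype.card W) with hR
  have hRN : N ≤ 2 ^ R := by
    rw [hNdef]; exact_mod_cast Nat.le_pow_clog (by norm_num) _
  have hRpos : 0 < R := Nat.clog_pos (by norm_num) hW
  have hR1 : (1 : ℝ) ≤ R := by exact_mod_cast hRpos
  have hRlow : (2 : ℝ) ^ (R - 1) ≤ N := by
    have := (Nat.pow_pred_clog_lt_self (b := 2) (by norm_num) (x := Fintype.card W) (by omega)).le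
    rw [hNdef]; exact_mod_cast this
  have hRl : (R : ℝ) ≤ 3 * l := by
    have h1 := Real.log_le_log (by positivity) hRlow
    rw [Real.log_pow, Nat.cast_sub hRpos] at h1
    push_cast at h1
    nlinarith
  have hRN' : (R : ℝ) ≤ N := by
    have h1 : l ≤ N - 1 := Real.log_le_sub_one_of_pos hN0
    have h2 : R ≤ Fintype.card W := by
      have h3 : 2 ^ (R - 1) ≤ Fintype.card W := by rw [hNdef] at hRlow; exact_mod_cast hRlow
      have h4 : R - 1 < 2 ^ (R - 1) := Nat.lt_two_pow_self
      omega
    rw [hNdef]; exact_mod_cast h2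
  -- Blocks are long enough for the exponential in Chernoff's bound to be at most `N ^ (-8)`.
  set h := ⌈32 * R ^ 2 * l / ρ⌉₊ with hh
  have hhle : 32 * R ^ 2 * l / ρ ≤ h := Nat.le_ceil _
  have hhpos : 0 < h := Nat.ceil_pos.2 (by positivity)
  have hh1 : (1 : ℝ) ≤ h := by exact_mod_cast hhpos
  have hhlt : (h : ℝ) ≤ 306 * l ^ 3 / ρ := by
    have h1 : (h : ℝ) < 32 * R ^ 2 * l / ρ + 1 := Nat.ceil_lt_add_one (by positivity)
    have h2 : (1 : ℝ) ≤ 2 * R ^ 2 * l / ρ := by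
      rw [le_div_iff₀ hρ]
      have : (1 : ℝ) ≤ (R : ℝ) ^ 2 := one_le_pow₀ hR1
      nlinarith
    calc (h : ℝ) ≤ 32 * R ^ 2 * l / ρ + 2 * R ^ 2 * l / ρ := by linarith
      _ = 34 * R ^ 2 * l / ρ := by ring
      _ ≤ 34 * (3 * l) ^ 2 * l / ρ := by gcongr
      _ = _ := by ring
  set ε : ℝ := 1 / R with hε
  have hε0 : 0 < ε := by positivity
  have hε1 : ε ≤ 1 := by rw [hε, div_le_one (by positivity)]; exact hR1
  set η : ℝ := 8 * N ^ 2 / ρ * Real.exp (-(h * ρ * ε ^ 2 / 4)) with hη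
  have hRη : R * η ≤ 1 / 2 := by
    have h1 : Real.exp (-(h * ρ * ε ^ 2 / 4)) ≤ (N ^ 8)⁻¹ := by
      rw [Real.exp_neg]
      refine inv_anti₀ (by positivity) ?_
      rw [← Real.exp_log (pow_pos hN0 8), Real.log_pow]
      refine Real.exp_le_exp.2 ?_
      rw [div_le_iff₀ hρ] at hhle
      rw [hε, div_pow, one_pow, mul_one_div, le_div_iff₀ (by norm_num), le_div_iff₀ (by positivity)]
      push_cast
      linarith
    have h2 : 1 / ρ ≤ N := by
      rw [div_le_iff₀ hρ, mul_comm, hρN]; exact hm1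
    calc R * η ≤ N * (8 * N ^ 2 * N * (N ^ 8)⁻¹) := by
          rw [hη, div_eq_mul_one_div]
          gcongr
      _ = 8 / N ^ 4 := by field_simp
      _ ≤ 8 / 2 ^ 4 := by gcongr
      _ = 1 / 2 := by norm_num
  obtain ⟨S⟩ := nonempty_walkSystem (ε := ε) (h := h) φ A Bf C hA hB hC hrel hWpos hhpos hm hρ hρN
    hε0 hε1 hη.ge R
  set V : ℝ := N ^ (h * R) with hV
  have hV0 : 0 < V := by positivity
  have hb3 : (1 + ε) ^ R ≤ 3 := by
    calc (1 + ε) ^ R ≤ Real.exp ε ^ R := by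
          gcongr
          linarith [Real.add_one_le_exp ε]
      _ = Real.exp 1 := by
          rw [← Real.exp_nat_mul, hε]
          congr 1
          field_simp
      _ ≤ 3 := Real.exp_one_lt_d9.le.trans (by norm_num)
  have hcX : (Fintype.card S.X : ℝ) = N * V := S.cardX
  have hcY : (Fintype.card S.Y : ℝ) = V := S.cardY
  have hkey := dimension_mul_le g hg S.posX S.posY (fun i => S.M (e i)) S.a ((1 + ε) ^ R) (V / 2)
    (fun i => S.M_nonneg _) S.a_nonneg (by positivity)
    (fun i x y hne => by rw [S.pos_eq _ x y hne, he]) (fun i => S.sum_left_le _)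
    (fun i => S.sum_right_le _)
    (fun i => by
      refine le_trans ?_ (S.le_total _)
      rw [div_eq_inv_mul]
      gcongr
      linarith)
    (by
      have : (0 : ℝ) < Fintype.card S.X := by rw [hcX]; positivity
      exact_mod_cast this)
  have hsa : ∑ x, S.a x ≤ 7 / ρ * V := by
    refine S.sum_a_le.trans ?_
    gcongr
    have h1 : N / 2 ^ R ≤ 1 := by rw [div_le_one (by positivity)]; exact hRN
    have h2 : 1 ≤ 1 / ρ := by rw [le_div_iff₀ hρ]; linarith
    have h3 : 7 / ρ = 1 / ρ + 6 / ρ := by ring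
    linarith
  have htot : ∑ x, S.a x + Fintype.card S.Y * (1 + ε) ^ R ≤ 10 / ρ * V := by
    have h2 : V * (1 + ε) ^ R ≤ 3 / ρ * V := by
      rw [mul_comm]
      gcongr
      refine hb3.trans ?_
      rw [le_div_iff₀ hρ]
      linarith
    rw [hcY]
    calc _ ≤ 7 / ρ * V + 3 / ρ * V := add_le_add hsa h2
      _ = _ := by ring
  have hlog : Real.log (Fintype.card S.X + Fintype.card S.Y) + 1 ≤ 4590 * l ^ 5 / ρ := by
    have h1 : Real.log (Fintype.card S.X + Fintype.card S.Y) ≤ (h * R + 2) * l := by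
      rw [hcX, hcY]
      calc Real.log (N * V + V) ≤ Real.log (N ^ (h * R + 2)) := by
            refine Real.log_le_log (by positivity) ?_
            have h0 : N + 1 ≤ N ^ 2 := by nlinarith
            calc N * V + V = V * (N + 1) := by ring
              _ ≤ V * N ^ 2 := by gcongr
              _ = _ := by rw [pow_add]
        _ = _ := by rw [Real.log_pow]; push_cast; ring
    have h3 : l ≤ h * R * l := le_mul_of_one_le_left hlpos.le
      (one_le_mul_of_one_le_of_one_le hh1 hR1)
    calc _ ≤ 5 * (h * R) * l := by linarith
      _ ≤ 5 * (306 * l ^ 3 / ρ * (3 * l)) * l := by gcongr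
      _ = _ := by ring
  have hlog0 : 0 ≤ Real.log (Fintype.card S.X + Fintype.card S.Y) + 1 := by
    have : 0 ≤ Real.log (Fintype.card S.X + Fintype.card S.Y) := by
      rw [hcX, hcY]
      refine Real.log_nonneg ?_
      have h1 : 1 ≤ V := one_le_pow₀ (by linarith)
      have h2 : 0 ≤ N * V := by positivity
      linarith
    linarith
  have h1 : 0.69 * (k * (V / 2)) ≤ 2 * (10 / ρ * V * (4590 * l ^ 5 / ρ)) :=
    calc 0.69 * (k * (V / 2)) ≤ Real.log 2 * (k * (V / 2)) := by gcongr
      _ ≤ _ := hkey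
      _ ≤ _ := by gcongr
  have h2 : 0.345 * (k : ℝ) * V ≤ 91800 * l ^ 5 / ρ ^ 2 * V := by
    calc 0.345 * (k : ℝ) * V = 0.69 * (k * (V / 2)) := by ring
      _ ≤ _ := h1
      _ = _ := by field_simp; ring
  have h3 := le_of_mul_le_mul_right h2 hV0
  have h4 : 300000 * l ^ 5 / ρ ^ 2 = 300000 / 91800 * (91800 * l ^ 5 / ρ ^ 2) := by ring
  have h5 : 0 ≤ 91800 * l ^ 5 / ρ ^ 2 := by positivity
  rw [h4]
  linarith

/-! ### Relations of a locally correctable code -/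

section LocalCorrection

variable {F : Type*} [Field F] {k n : ℕ} (L : (Fin k → F) →ₗ[F] (Fin n → F)) (u : Fin n)

/-- A decision tree that reads few symbols, on codewords with the positions of `E` erased to `0`,
is right about position `u` on at most half of the codewords that satisfy the constraints `Q` read
so far, provided that position `u` is not determined by the positions that it can read. -/
theorem QueryAlg.two_mul_card_correct_le [Fintype F] [DecidableEq F] (E : Finset (Fin n))
    {r : ℕ} (hfree : ∀ Q : List (Fin n), Q.length ≤ r → (∀ i ∈ Q, i ∉ E) →
      ∃ d, (∀ i ∈ Q, L d i = 0) ∧ L d u ≠ 0) {q : ℕ} (T : QueryAlg (Fin n) F q) :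
    ∀ Q : List (Fin n × F), Q.length + q ≤ r → (∀ p ∈ Q, p.1 ∉ E) →
      2 * (Finset.univ.filter fun b : Fin k → F => (∀ p ∈ Q, L b p.1 = p.2) ∧
        T.run (fun i => if i ∈ E then 0 else L b i) = L b u).card ≤
      (Finset.univ.filter fun b : Fin k → F => ∀ p ∈ Q, L b p.1 = p.2).card := by
  induction T with
  | output a =>
    intro Q hlen hQ
    obtain ⟨d, hd, hdu⟩ := hfree (Q.map Prod.fst) (by rw [List.length_map]; omega) (by simpa using hQ)
    simp only [QueryAlg.run]
    set s := Finset.univ.filter fun b : Fin k → F => (∀ p ∈ Q, L b p.1 = p.2) ∧ a = L b u with hs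
    -- Translation by `d` preserves the constraints and turns right answers into wrong ones.
    have hdisj : Disjoint s (s.map (addRightEmbedding d)) := by
      rw [Finset.disjoint_left]
      intro b hb hb'
      obtain ⟨b', hb'', rfl⟩ := Finset.mem_map.1 hb'
      rw [hs, Finset.mem_filter] at hb hb''
      have h1 := hb.2.2
      have h2 := hb''.2.2
      simp only [addRightEmbedding_apply, map_add, Pi.add_apply, ← h2] at h1
      exact hdu (by simpa using h1.symm)
    calc 2 * s.card = (s.disjUnion _ hdisj).card := by
          rw [Finset.card_disjUnion, Finset.card_map]; ring
      _ ≤ _ := by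
          refine Finset.card_le_card fun b hb => ?_
          simp only [Finset.mem_filter, Finset.mem_univ, true_and]
          rcases Finset.mem_disjUnion.1 hb with hb | hb
          · exact (Finset.mem_filter.1 hb).2.1
          · obtain ⟨b', hb', rfl⟩ := Finset.mem_map.1 hb
            intro p hp
            have h1 := (Finset.mem_filter.1 hb').2.1 p hp
            have h2 := hd p.1 (List.mem_map_of_mem hp)
            simp [h1, h2]
  | query i next ih =>
    intro Q hlen hQ
    simp only [QueryAlg.run]
    by_cases hi : i ∈ E
    · simpa [hi] using ih 0 Q (by omega) hQ
    · have hmaps : ∀ s : Finset (Fin k → F), s.card =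
          ∑ x : F, (s.filter fun b => L b i = x).card := fun s =>
        Finset.card_eq_sum_card_fiberwise fun b _ => Finset.mem_univ _
      rw [hmaps, hmaps, Finset.mul_sum]
      refine Finset.sum_le_sum fun x _ => ?_
      have hx := ih x ((i, x) :: Q) (by simp only [List.length_cons]; omega) (by
        intro p hp
        rcases List.mem_cons.1 hp with rfl | hp
        exacts [hi, hQ p hp])
      refine le_trans (Nat.mul_le_mul_left 2 (Finset.card_le_card ?_))
        (hx.trans (Finset.card_le_card ?_))
      · intro b
        simp only [Finset.mem_filter, Finset.mem_univ, true_and, List.mem_cons, if_neg hi]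
        rintro ⟨⟨h1, h2⟩, h3⟩
        refine ⟨?_, by rw [← h3]; exact h3 ▸ h2⟩
        rintro p (rfl | hp)
        exacts [h3, h1 p hp]
      · intro b
        simp only [Finset.mem_filter, Finset.mem_univ, true_and, List.mem_cons]
        exact fun h => ⟨fun p hp => h p (Or.inr hp), h (i, x) (Or.inl rfl)⟩

variable {L}

/-- After the erasure of at most `δ n` positions, position `u` of a codeword is still determined by
a few of the positions that are left. -/
theorem IsLCC.exists_determining [Fintype F] [DecidableEq F] {q : ℕ} {δ ε : ℝ} (hε : 0 < ε)
    (h : IsLCC q δ ε L) (E : Finset (Fin n)) (hE : (E.card : ℝ) ≤ δ * n) :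
    ∃ Q : List (Fin n), Q.length ≤ q ∧ (∀ i ∈ Q, i ∉ E) ∧
      ∀ d, (∀ i ∈ Q, L d i = 0) → L d u = 0 := by
  classical
  by_contra hcon
  push Not at hcon
  obtain ⟨Dec, hDec⟩ := h
  set y : (Fin k → F) → Fin n → F := fun b i => if i ∈ E then 0 else L b i with hy
  have hdist : ∀ b, (hammingDist (y b) (L b) : ℝ) ≤ δ * n := by
    intro b
    refine le_trans (Nat.cast_le.2 (Finset.card_le_card fun i hi => ?_)) hE
    by_contra hiE
    simp [hy, hiE] at hi
  have hcount : ∀ T : QueryAlg (Fin n) F q,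
      2 * (Finset.univ.filter fun b : Fin k → F => L b u = T.run (y b)).card ≤
        Fintype.card (Fin k → F) := by
    intro T
    have := QueryAlg.two_mul_card_correct_le L u E (r := q) hcon T [] (by simp) (by simp)
    simp only [List.not_mem_nil, false_imp_iff, implies_true, true_and, Finset.filter_true,
      Finset.card_univ] at this
    simpa only [eq_comm] using this
  have hsum : 2 * ∑ b : Fin k → F, ((Dec u).map (QueryAlg.run (y b))) (L b u) ≤
      (Fintype.card (Fin k → F) : ENNReal) := by
    simp_rw [PMF.map_apply]
    rw [← Summable.tsum_finsetSum fun _ _ => ENNReal.summable, ← ENNReal.tsum_mul_left]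
    calc _ ≤ ∑' T, (Dec u) T * (Fintype.card (Fin k → F) : ENNReal) := by
          refine ENNReal.tsum_le_tsum fun T => ?_
          have hT : (∑ b : Fin k → F, if L b u = T.run (y b) then (Dec u) T else 0) =
              (Finset.univ.filter fun b : Fin k → F => L b u = T.run (y b)).card * (Dec u) T := by
            rw [← Finset.sum_filter, Finset.sum_const, nsmul_eq_mul]
          calc _ = (Dec u) T * ((2 * (Finset.univ.filter fun b : Fin k → F =>
                L b u = T.run (y b)).card : ℕ) : ENNReal) := by
                push_cast
                rw [mul_comm _ (2 * _), mul_assoc, ← hT]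
                congr!
            _ ≤ _ := by
                gcongr
                exact_mod_cast hcount T
      _ = _ := by rw [ENNReal.tsum_mul_right, PMF.tsum_coe, one_mul]
  have hreal := ENNReal.toReal_mono (by simp) hsum
  rw [ENNReal.toReal_mul, ENNReal.toReal_sum fun b _ => PMF.apply_ne_top _ _] at hreal
  have hlow : ∑ _b : Fin k → F, (1 / 2 + ε) ≤
      ∑ b : Fin k → F, (((Dec u).map (QueryAlg.run (y b))) (L b u)).toReal :=
    Finset.sum_le_sum fun b _ => hDec b u (y b) (hdist b)
  rw [Finset.sum_const, Finset.card_univ, nsmul_eq_mul] at hlow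
  have hpos : (0 : ℝ) < Fintype.card (Fin k → F) := by exact_mod_cast Fintype.card_pos
  simp only [ENNReal.toReal_ofNat, ENNReal.toReal_natCast] at hreal
  nlinarith

/-- A linear functional that vanishes wherever three others do is a combination of them. -/
theorem exists_eq_combination {a b c : Fin n}
    (h : ∀ d, L d a = 0 → L d b = 0 → L d c = 0 → L d u = 0) :
    ∃ x y z : F, ∀ d, L d u = x * L d a + y * L d b + z * L d c := by
  have hmem := mem_span_of_iInf_ker_le_ker (𝕜 := F) (ι := Fin 3)
    (L := fun j => (LinearMap.proj (![a, b, c] j)).comp L) (K := (LinearMap.proj u).comp L) (by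
      intro d hd
      simp only [Submodule.mem_iInf, LinearMap.mem_ker, LinearMap.comp_apply,
        LinearMap.proj_apply] at hd ⊢
      exact h d (hd 0) (hd 1) (hd 2))
  obtain ⟨x, hx⟩ := (Submodule.mem_span_range_iff_exists_fun F).1 hmem
  refine ⟨x 0, x 1, x 2, fun d => ?_⟩
  have := LinearMap.congr_fun hx d
  simpa [Fin.sum_univ_three] using this.symm

theorem exists_triple_of_length_le {α : Type*} {P : α → Prop} {i₀ : α} (h₀ : P i₀) :
    ∀ Q : List α, Q.length ≤ 3 → (∀ i ∈ Q, P i) →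
      ∃ a b c, P a ∧ P b ∧ P c ∧ ∀ i ∈ Q, i = a ∨ i = b ∨ i = c
  | [], _, _ => ⟨i₀, i₀, i₀, h₀, h₀, h₀, by simp⟩
  | [a], _, h => ⟨a, a, a, by simp_all⟩
  | [a, b], _, h => ⟨a, b, b, by simp_all⟩
  | [a, b, c], _, h => ⟨a, b, c, by simp_all⟩
  | _ :: _ :: _ :: _ :: _, h, _ => by simp at h; omega

/-- If `δ ≥ 1`, all positions can be erased, which leaves nothing to determine a nonzero symbol. -/
theorem IsLCC.lt_one [Fintype F] [DecidableEq F] {q : ℕ} {δ ε : ℝ} (hL : Function.Injective L)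
    (hk : 0 < k) (hε : 0 < ε) (h : IsLCC q δ ε L) : δ < 1 := by
  by_contra hδ
  push Not at hδ
  have h1 : L (Pi.single ⟨0, hk⟩ 1) ≠ 0 := by
    rw [Ne, map_eq_zero_iff _ hL]
    simp
  obtain ⟨u, hu⟩ := Function.ne_iff.1 h1
  obtain ⟨Q, -, hQ, hd⟩ := h.exists_determining u hε Finset.univ (by
    rw [Finset.card_univ, Fintype.card_fin]
    exact le_mul_of_one_le_left (Nat.cast_nonneg n) hδ)
  exact hu (hd _ fun i hi => absurd (Finset.mem_univ i) (hQ i hi))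

/-- Greedy choice of `m` relations for position `u`. The entries of one relation may coincide, but
different relations have no entry in common. -/
theorem IsLCC.exists_relations [Fintype F] [DecidableEq F] {δ ε : ℝ} (hL : Function.Injective L)
    (hk : 0 < k) (hε : 0 < ε) (h : IsLCC 3 δ ε L) (hn : 0 < n) :
    ∀ m : ℕ, 3 * ((m : ℝ) - 1) ≤ δ * n → ∃ (a b c : Fin m → Fin n) (x y z : Fin m → F),
      Function.Injective a ∧ Function.Injective b ∧ Function.Injective c ∧
      ∀ t d, L d u = x t * L d (a t) + y t * L d (b t) + z t * L d (c t) := by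
  classical
  intro m
  induction m with
  | zero =>
    exact fun _ => ⟨Fin.elim0, Fin.elim0, Fin.elim0, Fin.elim0, Fin.elim0, Fin.elim0,
      fun t => t.elim0, fun t => t.elim0, fun t => t.elim0, fun t => t.elim0⟩
  | succ m ih =>
    intro hm
    push_cast at hm
    obtain ⟨a, b, c, x, y, z, ha, hb, hc, hr⟩ := ih (by linarith)
    set E := Finset.univ.image a ∪ Finset.univ.image b ∪ Finset.univ.image c with hE
    have hEcard : E.card ≤ 3 * m := by
      have h1 : ∀ f : Fin m → Fin n, (Finset.univ.image f).card ≤ m := fun f =>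
        Finset.card_image_le.trans (by simp)
      have h2 : E.card ≤ _ := Finset.card_union_le (Finset.univ.image a ∪ Finset.univ.image b)
        (Finset.univ.image c)
      have h3 := Finset.card_union_le (Finset.univ.image a) (Finset.univ.image b)
      have := h1 a
      have := h1 b
      have := h1 c
      omega
    have hEδ : (E.card : ℝ) ≤ δ * n := by
      have : (E.card : ℝ) ≤ 3 * m := by exact_mod_cast hEcard
      linarith
    obtain ⟨i₀, hi₀⟩ : ∃ i, i ∉ E := by
      by_contra hcon
      push Not at hcon
      have h1 : E = Finset.univ := Finset.eq_univ_iff_forall.2 hcon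
      rw [h1, Finset.card_univ, Fintype.card_fin] at hEδ
      have h2 := h.lt_one hL hk hε
      have h3 : (0 : ℝ) < n := by exact_mod_cast hn
      nlinarith
    obtain ⟨Q, hlen, hQ, hd⟩ := h.exists_determining u hε E hEδ
    obtain ⟨a', b', c', ha', hb', hc', hall⟩ := exists_triple_of_length_le (P := (· ∉ E)) hi₀ Q hlen hQ
    obtain ⟨x', y', z', hr'⟩ := exists_eq_combination (L := L) u (a := a') (b := b') (c := c')
      fun d h1 h2 h3 => hd d fun i hi => by
        rcases hall i hi with rfl | rfl | rfl <;> assumption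
    simp only [hE, Finset.mem_union, Finset.mem_image, Finset.mem_univ, true_and, not_or,
      not_exists] at ha' hb' hc'
    refine ⟨Fin.cons a' a, Fin.cons b' b, Fin.cons c' c, Fin.cons x' x, Fin.cons y' y,
      Fin.cons z' z, ?_, ?_, ?_, ?_⟩
    · exact Fin.cons_injective_iff.2 ⟨by rintro ⟨t, ht⟩; exact ha'.1.1 t ht, ha⟩
    · exact Fin.cons_injective_iff.2 ⟨by rintro ⟨t, ht⟩; exact hb'.1.2 t ht, hb⟩
    · exact Fin.cons_injective_iff.2 ⟨by rintro ⟨t, ht⟩; exact hc'.2 t ht, hc⟩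
    · intro t d
      refine Fin.cases ?_ (fun t => ?_) t
      · simpa using hr' d
      · simpa using hr t d

/-- An injective linear code has an information set: positions `e` and messages `d` whose codewords
restrict to the standard basis on these positions. -/
theorem exists_information_set (hL : Function.Injective L) :
    ∃ (e : Fin k → Fin n) (d : Fin k → Fin k → F), ∀ i j, L (d i) (e j) = (Pi.single i 1 : Fin k → F) j := by
  set v : Fin n → Module.Dual F (Fin k → F) := fun u => (LinearMap.proj u).comp L with hv
  have hspan : Submodule.span F (Set.range v) = ⊤ := by
    refine eq_top_iff.2 fun K _ => mem_span_of_iInf_ker_le_ker ?_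
    intro w hw
    have hw0 : w = 0 := by
      refine hL ?_
      rw [map_zero]
      ext u
      simpa [hv] using (Submodule.mem_iInf _).1 hw u
    simp [hw0]
  obtain ⟨s, hs, hspan', hli⟩ := exists_linearIndependent F (Set.range v)
  have hB : ∃ B : Module.Basis s F (Module.Dual F (Fin k → F)), ∀ i, B i = i :=
    ⟨Module.Basis.mk hli (by rw [Subtype.range_coe, hspan', hspan]), fun i => by simp⟩
  obtain ⟨B, hB⟩ := hB
  have σ := (Pi.basisFun F (Fin k)).dualBasis.indexEquiv B
  choose e he using fun j => hs (σ j).2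
  set T : (Fin k → F) →ₗ[F] (Fin k → F) := LinearMap.pi fun j => v (e j) with hT
  have hTinj : Function.Injective T := by
    rw [← LinearMap.ker_eq_bot, LinearMap.ker_eq_bot']
    intro w hw
    have h0 : Module.Dual.eval F (Fin k → F) w = 0 := by
      refine B.ext fun i => ?_
      have h1 := congr_fun hw (σ.symm i)
      simp only [hT, LinearMap.pi_apply, he, Equiv.apply_symm_apply, Pi.zero_apply] at h1
      rw [hB]
      simpa using h1
    refine hL ?_
    rw [map_zero]
    ext u
    simpa [hv] using LinearMap.congr_fun h0 (v u)
  choose d hd using fun i => LinearMap.injective_iff_surjective.1 hTinj (Pi.single i (1 : F))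
  exact ⟨e, d, fun i j => by rw [← hd i]; rfl⟩

end LocalCorrection

/-! ### The bound on the length -/

/-- The polylogarithmic bound on the dimension. The tokens are the multiples of the positions, and
the relations of a position are the moves at its multiples. -/
theorem IsLCC.dimension_le {F : Type u} [Field F] [Fintype F] [DecidableEq F] {k n : ℕ}
    {δ ε : ℝ} {L : (Fin k → F) →ₗ[F] (Fin n → F)} (hL : Function.Injective L) (hn : 2 ≤ n)
    (hδ : 0 < δ) (hε : 0 < ε) (h : IsLCC 3 δ ε L) :
    δ ^ 2 * (k : ℝ) / ((Fintype.card F : ℝ) - 1) ^ 2 ≤ 10 ^ 10 * Real.logb 2 n ^ 8 := by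
  set Λ := Real.logb 2 n with hΛ
  have hnr : (2 : ℝ) ≤ n := by exact_mod_cast hn
  have hΛ1 : 1 ≤ Λ := by
    rw [hΛ, Real.le_logb_iff_rpow_le (by norm_num) (by linarith)]
    simpa using hnr
  rcases Nat.eq_zero_or_pos k with rfl | hk
  · simp only [Nat.cast_zero, mul_zero, zero_div]
    positivity
  have hδ1 := h.lt_one hL hk hε
  set P : ℝ := ((Fintype.card F : ℕ) : ℝ) with hP
  have hP2 : 2 ≤ P := by rw [hP]; exact_mod_cast Fintype.one_lt_card (α := F)
  have hP0 : 0 < P - 1 := by linarith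
  by_cases hbig : (n : ℝ) ^ 2 < P
  · -- The field is so large that the trivial bound `k ≤ n` suffices.
    have hkn : (k : ℝ) ≤ n := by
      have := LinearMap.finrank_le_finrank_of_injective hL
      rw [Module.finrank_fin_fun, Module.finrank_fin_fun] at this
      exact_mod_cast this
    have h1 : (n : ℝ) ≤ P - 1 := by nlinarith
    calc δ ^ 2 * (k : ℝ) / (P - 1) ^ 2 ≤ 1 * (P - 1) / (P - 1) ^ 2 := by
          gcongr
          · exact pow_le_one₀ hδ.le hδ1.le
          · linarith
      _ = 1 / (P - 1) := by field_simp
      _ ≤ 1 := by rw [div_le_one hP0]; linarith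
      _ ≤ 10 ^ 10 * 1 ^ 8 := by norm_num
      _ ≤ _ := by gcongr
  push Not at hbig
  set m := ⌊δ * n / 3⌋₊ + 1 with hm
  have hm3 : 3 * ((m : ℝ) - 1) ≤ δ * n := by
    have := Nat.floor_le (a := δ * n / 3) (by positivity)
    rw [hm]
    push_cast
    linarith
  have hmlow : δ * n / 3 ≤ m := by
    rw [hm]
    push_cast
    exact (Nat.lt_floor_add_one _).le
  choose a b c x y z ha hb hc hr using fun u => h.exists_relations u hL hk hε (by omega) m hm3
  obtain ⟨e, d, hed⟩ := exists_information_set hL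
  have hcard : (Fintype.card (Fin n × F) : ℝ) = n * P := by simp [hP]
  have hkey := dimension_le_of_moves (1 : F) one_ne_zero (W := Fin n × F)
    (fun s i => s.2 * L (d i) s.1)
    (fun s t => (a s.1 t, s.2 * x s.1 t)) (fun s t => (b s.1 t, -(s.2 * y s.1 t)))
    (fun s t => (c s.1 t, s.2 * z s.1 t))
    (fun s t t' htt => ha s.1 (Prod.ext_iff.1 htt).1)
    (fun s t t' htt => hb s.1 (Prod.ext_iff.1 htt).1)
    (fun s t t' htt => hc s.1 (Prod.ext_iff.1 htt).1)
    (fun s t => by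
      ext i
      simp only [Pi.add_apply, Pi.sub_apply]
      rw [hr s.1 t (d i)]
      ring)
    (by
      have : (2 : ℝ) ≤ Fintype.card (Fin n × F) := by rw [hcard]; nlinarith
      exact_mod_cast this)
    (Nat.succ_pos _) (fun i => (e i, 1))
    (fun i => by
      ext j
      simp only [one_mul]
      rw [hed j i, Pi.single_apply, Pi.single_apply, if_congr eq_comm rfl rfl])
  rw [hcard] at hkey
  have hlog : Real.log (n * P) ≤ 3 * Λ := by
    have h1 : Real.log (n * P) ≤ 3 * Real.log n := by
      calc Real.log (n * P) ≤ Real.log (n ^ 3) := by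
            refine Real.log_le_log (by positivity) ?_
            calc (n : ℝ) * P ≤ n * n ^ 2 := by gcongr
              _ = _ := by ring
        _ = _ := by rw [Real.log_pow]; norm_num
    have h2 : Real.log n ≤ Λ := by
      rw [hΛ, Real.logb, le_div_iff₀ (Real.log_pos (by norm_num))]
      have h3 : 0 ≤ Real.log n := Real.log_nonneg (by linarith)
      have h4 : Real.log 2 ≤ 1 := Real.log_two_lt_d9.le.trans (by norm_num)
      exact mul_le_of_le_one_right h3 h4
    linarith
  have hlog0 : 0 ≤ Real.log (n * P) := Real.log_nonneg (by nlinarith)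
  have hρ : δ / (6 * (P - 1)) ≤ m / (n * P) := by
    rw [div_le_div_iff₀ (by positivity) (by positivity)]
    have hP' : P ≤ 2 * (P - 1) := by linarith
    calc δ * (n * P) ≤ δ * (n * (2 * (P - 1))) := by gcongr
      _ = δ * n / 3 * (6 * (P - 1)) := by ring
      _ ≤ _ := by gcongr
  have hk' : (k : ℝ) ≤ 300000 * (3 * Λ) ^ 5 / (δ / (6 * (P - 1))) ^ 2 := by
    refine hkey.trans ?_
    gcongr
  calc δ ^ 2 * (k : ℝ) / (P - 1) ^ 2
      ≤ δ ^ 2 * (300000 * (3 * Λ) ^ 5 / (δ / (6 * (P - 1))) ^ 2) / (P - 1) ^ 2 := by gcongr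
    _ = 2624400000 * Λ ^ 5 := by
        field_simp
        ring
    _ ≤ 10 ^ 10 * Λ ^ 8 := by
        gcongr
        · norm_num
        · norm_num

theorem two_rpow_le_of_le_logb_pow {K Q n : ℝ} (hK : 0 < K) (hQ : 0 ≤ Q) (hn : 2 ≤ n)
    (h : Q ≤ K * Real.logb 2 n ^ 8) :
    (2 : ℝ) ^ ((K ^ (1 / 8 : ℝ))⁻¹ * Q ^ (1 / 8 : ℝ)) ≤ n := by
  have hΛ : 0 ≤ Real.logb 2 n := Real.logb_nonneg (by norm_num) (by linarith)
  have h1 : Q ^ (1 / 8 : ℝ) ≤ K ^ (1 / 8 : ℝ) * Real.logb 2 n := by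
    calc Q ^ (1 / 8 : ℝ) ≤ (K * Real.logb 2 n ^ 8) ^ (1 / 8 : ℝ) :=
          Real.rpow_le_rpow hQ h (by norm_num)
      _ = K ^ (1 / 8 : ℝ) * Real.logb 2 n := by
          rw [Real.mul_rpow hK.le (by positivity), ← Real.rpow_natCast, ← Real.rpow_mul hΛ]
          norm_num
  calc (2 : ℝ) ^ ((K ^ (1 / 8 : ℝ))⁻¹ * Q ^ (1 / 8 : ℝ)) ≤ 2 ^ Real.logb 2 n := by
        refine Real.rpow_le_rpow_of_exponent_le (by norm_num) ?_
        rw [inv_mul_le_iff₀ (by positivity)]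
        exact h1
    _ = n := Real.rpow_logb (by norm_num) (by norm_num) (by linarith)

theorem mainTheorem1 :
    (∃ c : ℝ, 0 < c ∧
      ∀ (F : Type*) [Field F] [Fintype F] [DecidableEq F] (k n : ℕ) (δ ε : ℝ)
        (L : (Fin k → F) →ₗ[F] (Fin n → F)),
        Function.Injective L → 2 ≤ n → 0 < δ → 0 < ε → IsLCC 3 δ ε L →
          (2 : ℝ) ^ (c * (δ ^ 2 * (k : ℝ) / ((Fintype.card F : ℝ) - 1) ^ 2) ^ (1 / 8 : ℝ))
            ≤ (n : ℝ)) ∧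
    (∀ δ : ℝ, 0 < δ → ∃ c : ℝ, 0 < c ∧
      ∀ (k n : ℕ) (ε : ℝ) (L : (Fin k → ZMod 2) →ₗ[ZMod 2] (Fin n → ZMod 2)),
        Function.Injective L → 2 ≤ n → 0 < ε → IsLCC 3 δ ε L →
          (2 : ℝ) ^ (c * (k : ℝ) ^ (1 / 8 : ℝ)) ≤ (n : ℝ)) := by
  refine ⟨⟨((10 ^ 10 : ℝ) ^ (1 / 8 : ℝ))⁻¹, by positivity, ?_⟩, fun δ hδ =>
    ⟨((10 ^ 10 / δ ^ 2 : ℝ) ^ (1 / 8 : ℝ))⁻¹, by positivity, ?_⟩⟩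
  · intro F _ _ _ k n δ ε L hL hn hδ hε h
    exact two_rpow_le_of_le_logb_pow (by positivity) (by positivity) (by exact_mod_cast hn)
      (h.dimension_le hL hn hδ hε)
  · intro k n ε L hL hn hε h
    refine two_rpow_le_of_le_logb_pow (by positivity) (by positivity) (by exact_mod_cast hn) ?_
    have h1 := h.dimension_le hL hn hδ hε
    rw [ZMod.card] at h1
    norm_num at h1
    rw [div_mul_eq_mul_div, le_div_iff₀ (by positivity), mul_comm]
    linarith
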